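/- Let $\Omega=\{0,1\}^{\mathbb N}$ (with $0\in\mathbb N$) and let $\sigma\colon\Omega\to\Omega$ be the shift, $\sigma(x)_n=x_{n+1}$. Let $\mathbf a=(a_n)_{n\in\mathbb N}$ be an evanescent sequence: a strictly decreasing sequence of positive numbers converging to $0$ with $\frac{a_{n+1}}{a_n}=O\big(2^{-2^{n+2}}\big)$. Let $d_{\mathbf a}$ be the metric on $\Omega$ with $d_{\mathbf a}(x,x)=0$ and, for $x\neq y$, $d_{\mathbf a}(x,y)=a_m$ where $m$ is the least index with $x_m\ne y_m$. Let $C^{\mathbf a}(\Omega)$ be the Banach space of real-valued $d_{\mathbf a}$-Lipschitz functions on $\Omega$ with the norm $\|f\|_{\mathrm{Lip}}=\|f\|_\infty+\mathrm{Lip}(f)$, where $\mathrm{Lip}(f)$ is the least Lipschitz constant of $f$ with respect to $d_{\mathbf a}$. For a continuous $f\colon\Omega\to\mathbb R$, a $\sigma$-invariant Borel probability measure $\mu$ is maximizing if $\int f\,d\mu=\sup_\nu\int f\,d\nu$, where $\nu$ ranges over all $\sigma$-invariant Borel probability measures. A function $f\in C^{\mathbf a}(\Omega)$ has the locking property if it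 has a unique maximizing measure $\mu$, this $\mu$ is supported on a periodic orbit of $\sigma$, and $\mu$ is also the unique maximizing measure of every $g\in C^{\mathbf a}(\Omega)$ sufficiently close to $f$ in the norm $\|\cdot\|_{\mathrm{Lip}}$. Let $\mathsf L_{\mathbf a}\subset C^{\mathbf a}(\Omega)$ be the set of functions with the locking property. Then $\mathsf L_{\mathbf a}$ is prevalent in $C^{\mathbf a}(\Omega)$: its complement is contained in a Borel set $S\subset C^{\mathbf a}(\Omega)$ that is shy, i.e. for which there is a compactly supported Borel probability measure $P$ on $C^{\mathbf a}(\Omega)$ with $P(S+v)=0$ for every $v\in C^{\mathbf a}(\Omega)$. -/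

import Mathlib

open MeasureTheory Filter Topology Asymptotics
open scoped NNReal

noncomputable section

set_option linter.unusedSectionVars false

/-! ### Shy and prevalent sets -/

section Prevalence

variable {V : Type*} [AddCommGroup V] [Module ℝ V] [TopologicalSpace V]
  [IsTopologicalAddGroup V] [ContinuousSMul ℝ V] [TopologicalSpace.IsCompletelyMetrizableSpace V]
  [MeasurableSpace V] [BorelSpace V]

/-- A Borel subset `S` of a completely metrizable vector space is *shy* if some compactly supported
Borel probability measure gives measure zero to every translate of `S`. -/
def IsShy (S : Set V) : Prop :=
  MeasurableSet S ∧ ∃ μ : Measure V, IsProbabilityMeasure μ ∧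
    (∃ K : Set V, IsCompact K ∧ μ Kᶜ = 0) ∧ ∀ v : V, μ ((fun x => x + v) '' S) = 0

/-- A set is *prevalent* if its complement is contained in a (Borel) shy set. -/
def IsPrevalent (P : Set V) : Prop :=
  ∃ S : Set V, IsShy S ∧ Pᶜ ⊆ S

end Prevalence

/-! ### The Banach space of Lipschitz functions -/

section Lipschitz

variable (X : Type*) [MetricSpace X] [CompactSpace X]

/-- The linear space of real Lipschitz functions on `X`, inside the continuous functions. -/
def lipSubmodule : Submodule ℝ C(X, ℝ) where
  carrier := {f | ∃ K : ℝ≥0, LipschitzWith K f}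
  zero_mem' := ⟨0, LipschitzWith.const 0⟩
  add_mem' := by
    rintro f g ⟨K, hK⟩ ⟨L, hL⟩
    exact ⟨K + L, hK.add hL⟩
  smul_mem' := by
    rintro c f ⟨K, hK⟩
    refine ⟨‖c‖₊ * K, LipschitzWith.of_dist_le_mul fun x y => ?_⟩
    have h := hK.dist_le_mul x y
    simp only [ContinuousMap.coe_smul, Pi.smul_apply, dist_smul₀, NNReal.coe_mul, coe_nnnorm]
    rw [mul_assoc]
    exact mul_le_mul_of_nonneg_left h (norm_nonneg c)

/-- The space `C^Lip(X)` of real Lipschitz functions on `X`. It is a type synonym, so that it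
carries the Lipschitz norm below and not the supremum norm. -/
def CLip : Type _ := lipSubmodule X

namespace CLip

instance : AddCommGroup (CLip X) := inferInstanceAs (AddCommGroup (lipSubmodule X))

instance : Module ℝ (CLip X) := inferInstanceAs (Module ℝ (lipSubmodule X))

variable {X}

/-- The underlying continuous function. -/
def toCont (f : CLip X) : C(X, ℝ) := Subtype.val (p := fun g => g ∈ lipSubmodule X) f

theorem toCont_injective : Function.Injective (toCont : CLip X → C(X, ℝ)) :=
  Subtype.val_injective

theorem toCont_add (f g : CLip X) : (f + g).toCont = f.toCont + g.toCont := rfl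

theorem toCont_smul (c : ℝ) (f : CLip X) : (c • f).toCont = c • f.toCont := rfl

theorem toCont_sub (f g : CLip X) : (f - g).toCont = f.toCont - g.toCont := rfl

theorem toCont_zero : (0 : CLip X).toCont = 0 := rfl

theorem exists_lipschitz (f : CLip X) : ∃ K : ℝ≥0, LipschitzWith K f.toCont :=
  Subtype.property (p := fun g => g ∈ lipSubmodule X) f

/-- The least Lipschitz constant of `f`. -/
def lip (f : CLip X) : ℝ≥0 := sInf {K : ℝ≥0 | LipschitzWith K f.toCont}

theorem lip_le {f : CLip X} {K : ℝ≥0} (h : LipschitzWith K f.toCont) : f.lip ≤ K :=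
  csInf_le (OrderBot.bddBelow _) h

theorem lipschitzWith_lip (f : CLip X) : LipschitzWith f.lip f.toCont := by
  refine LipschitzWith.of_dist_le_mul fun x y => ?_
  refine le_of_forall_pos_le_add fun ε hε => ?_
  have hd : (0 : ℝ) < dist x y + 1 := by positivity
  obtain ⟨K, hK, hlt⟩ := exists_lt_of_csInf_lt (s := {K : ℝ≥0 | LipschitzWith K f.toCont})
    f.exists_lipschitz (b := f.lip + Real.toNNReal (ε / (dist x y + 1)))
    (lt_add_of_pos_right _ (Real.toNNReal_pos.mpr (div_pos hε hd)))
  have h1 := LipschitzWith.dist_le_mul hK x y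
  have h2 : (K : ℝ) ≤ f.lip + ε / (dist x y + 1) := by
    have h := NNReal.coe_le_coe.mpr hlt.le
    rwa [NNReal.coe_add, Real.coe_toNNReal _ (div_pos hε hd).le] at h
  have h3 : ε / (dist x y + 1) * dist x y ≤ ε := by
    rw [div_mul_eq_mul_div, div_le_iff₀ hd]
    nlinarith [dist_nonneg (x := x) (y := y)]
  nlinarith [mul_le_mul_of_nonneg_right h2 (dist_nonneg (x := x) (y := y))]

/-- The Lipschitz norm: supremum norm plus least Lipschitz constant. -/
instance : Norm (CLip X) := ⟨fun f => ‖f.toCont‖ + f.lip⟩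

theorem norm_eq (f : CLip X) : ‖f‖ = ‖f.toCont‖ + f.lip := rfl

theorem lip_add_le (f g : CLip X) : (f + g).lip ≤ f.lip + g.lip :=
  lip_le (f.lipschitzWith_lip.add g.lipschitzWith_lip)

theorem lip_smul_le (c : ℝ) (f : CLip X) : (c • f).lip ≤ ‖c‖₊ * f.lip := by
  refine lip_le (LipschitzWith.of_dist_le_mul fun x y => ?_)
  have h := f.lipschitzWith_lip.dist_le_mul x y
  simp only [toCont_smul, ContinuousMap.coe_smul, Pi.smul_apply, dist_smul₀, NNReal.coe_mul,
    coe_nnnorm]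
  rw [mul_assoc]
  exact mul_le_mul_of_nonneg_left h (norm_nonneg c)

theorem lip_smul (c : ℝ) (f : CLip X) : (c • f).lip = ‖c‖₊ * f.lip := by
  refine le_antisymm (lip_smul_le c f) ?_
  rcases eq_or_ne c 0 with rfl | hc
  · simp
  · have h := lip_smul_le c⁻¹ (c • f)
    rw [smul_smul, inv_mul_cancel₀ hc, one_smul, nnnorm_inv] at h
    have hc' : ‖c‖₊ ≠ 0 := by simpa using hc
    calc ‖c‖₊ * f.lip ≤ ‖c‖₊ * (‖c‖₊⁻¹ * (c • f).lip) := mul_le_mul_right h _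
      _ = (c • f).lip := by rw [← mul_assoc, mul_inv_cancel₀ hc', one_mul]

theorem normCore : NormedSpace.Core ℝ (CLip X) where
  norm_nonneg f := by rw [norm_eq]; positivity
  norm_smul c f := by
    rw [norm_eq, norm_eq, toCont_smul, norm_smul, lip_smul, NNReal.coe_mul, coe_nnnorm]; ring
  norm_triangle f g := by
    rw [norm_eq, norm_eq, norm_eq, toCont_add]
    have h1 := norm_add_le f.toCont g.toCont
    have h2 : ((f + g).lip : ℝ) ≤ f.lip + g.lip := by exact_mod_cast lip_add_le f g
    linarith
  norm_eq_zero_iff f := by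
    constructor
    · intro h
      rw [norm_eq] at h
      have h0 : ‖f.toCont‖ = 0 :=
        le_antisymm (by linarith [f.lip.coe_nonneg]) (norm_nonneg _)
      exact toCont_injective (by rw [toCont_zero]; exact norm_eq_zero.mp h0)
    · rintro rfl
      have h : (0 : CLip X).lip = 0 :=
        le_antisymm (lip_le (by rw [toCont_zero]; exact LipschitzWith.const 0)) bot_le
      rw [norm_eq, h, toCont_zero]; simp

instance : NormedAddCommGroup (CLip X) := NormedAddCommGroup.ofCore normCore

instance : NormedSpace ℝ (CLip X) := NormedSpace.ofCore normCore

theorem norm_toCont_le (f : CLip X) : ‖f.toCont‖ ≤ ‖f‖ := by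
  rw [norm_eq]; linarith [f.lip.coe_nonneg]

theorem lip_le_norm (f : CLip X) : (f.lip : ℝ) ≤ ‖f‖ := by
  rw [norm_eq]; linarith [norm_nonneg f.toCont]

instance : CompleteSpace (CLip X) := by
  refine Metric.complete_of_cauchySeq_tendsto fun u hu => ?_
  have hc : CauchySeq fun n => (u n).toCont := by
    rw [Metric.cauchySeq_iff] at hu ⊢
    intro ε hε
    obtain ⟨N, hN⟩ := hu ε hε
    refine ⟨N, fun m hm n hn => ?_⟩
    have h := hN m hm n hn
    rw [dist_eq_norm] at h ⊢
    rw [← toCont_sub]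
    exact (norm_toCont_le _).trans_lt h
  obtain ⟨F, hF⟩ := cauchySeq_tendsto_of_complete hc
  have hpt : ∀ x, Tendsto (fun n => (u n).toCont x) atTop (𝓝 (F x)) := fun x =>
    ((continuous_eval_const x).tendsto F).comp hF
  have key : ∀ ε : ℝ≥0, 0 < ε → ∃ N, ∀ n ≥ N, LipschitzWith ε (F - (u n).toCont) := by
    intro ε hε
    obtain ⟨N, hN⟩ := Metric.cauchySeq_iff.mp hu ε hε
    refine ⟨N, fun n hn => LipschitzWith.of_dist_le_mul fun x y => ?_⟩
    have hlim : Tendsto (fun m => dist ((u m - u n).toCont x) ((u m - u n).toCont y)) atTop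
        (𝓝 (dist ((F - (u n).toCont) x) ((F - (u n).toCont) y))) := by
      simp only [toCont_sub, ContinuousMap.sub_apply]
      exact ((hpt x).sub_const _).dist ((hpt y).sub_const _)
    refine le_of_tendsto hlim ?_
    filter_upwards [eventually_ge_atTop N] with m hm
    have h1 := hN m hm n hn
    rw [dist_eq_norm] at h1
    exact ((u m - u n).lipschitzWith_lip.dist_le_mul x y).trans
      (mul_le_mul_of_nonneg_right ((lip_le_norm _).trans h1.le) dist_nonneg)
  have hFmem : F ∈ lipSubmodule X := by
    obtain ⟨N, hN⟩ := key 1 one_pos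
    have h1 : F - (u N).toCont ∈ lipSubmodule X := ⟨1, hN N le_rfl⟩
    have h2 : (u N).toCont ∈ lipSubmodule X := (u N).exists_lipschitz
    simpa using (lipSubmodule X).add_mem h1 h2
  let f : CLip X := (⟨F, hFmem⟩ : lipSubmodule X)
  have hf : f.toCont = F := rfl
  refine ⟨f, Metric.tendsto_atTop.mpr fun ε hε => ?_⟩
  obtain ⟨N₁, hN₁⟩ := Metric.tendsto_atTop.mp hF (ε / 2) (by positivity)
  obtain ⟨N₂, hN₂⟩ := key (Real.toNNReal (ε / 3)) (Real.toNNReal_pos.mpr (by positivity))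
  refine ⟨max N₁ N₂, fun n hn => ?_⟩
  have h1 := hN₁ n (le_of_max_le_left hn)
  have h2 : ((f - u n).lip : ℝ) ≤ ε / 3 := by
    have h := NNReal.coe_le_coe.mpr (lip_le (f := f - u n) (hN₂ n (le_of_max_le_right hn)))
    rwa [Real.coe_toNNReal _ (by positivity : (0 : ℝ) ≤ ε / 3)] at h
  rw [dist_comm, dist_eq_norm] at h1 ⊢
  rw [norm_eq, toCont_sub, hf]
  linarith

instance : MeasurableSpace (CLip X) := borel _

instance : BorelSpace (CLip X) := ⟨rfl⟩

end CLip

end Lipschitz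

/-! ### Ergodic optimization -/

section ErgodicOptimization

variable {X : Type*} [MetricSpace X] [CompactSpace X] [MeasurableSpace X] [BorelSpace X]

/-- The set of `T`-invariant Borel probability measures. -/
def invariantMeasures (T : C(X, X)) : Set (Measure X) :=
  {μ | IsProbabilityMeasure μ ∧ MeasurePreserving T μ μ}

/-- `μ` is a periodic measure: an invariant probability measure supported on a periodic orbit. -/
def IsPeriodicMeasure (T : C(X, X)) (μ : Measure X) : Prop :=
  μ ∈ invariantMeasures T ∧
    ∃ x ∈ Function.periodicPts T, μ (Set.range fun n : ℕ => T^[n] x)ᶜ = 0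

/-- The ergodic supremum of `f`. -/
def ergSup (T : C(X, X)) (f : C(X, ℝ)) : ℝ :=
  sSup ((fun μ : Measure X => ∫ x, f x ∂μ) '' invariantMeasures T)

/-- `μ` is a maximizing measure for `f`. -/
def IsMaximizing (T : C(X, X)) (f : C(X, ℝ)) (μ : Measure X) : Prop :=
  μ ∈ invariantMeasures T ∧ ∫ x, f x ∂μ = ergSup T f

/-- `μ` is the unique maximizing measure for `f`. -/
def IsUniqueMaximizing (T : C(X, X)) (f : C(X, ℝ)) (μ : Measure X) : Prop :=
  IsMaximizing T f μ ∧ ∀ ν : Measure X, IsMaximizing T f ν → ν = μ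

/-- The Lipschitz function `f` has the locking property: it has a unique maximizing measure, which
is periodic and is the unique maximizing measure of all functions close to `f` in the Lipschitz
norm. -/
def HasLocking (T : C(X, X)) (f : CLip X) : Prop :=
  ∃ μ : Measure X, IsPeriodicMeasure T μ ∧ IsUniqueMaximizing T f.toCont μ ∧
    ∃ ε > 0, ∀ g : CLip X, ‖g - f‖ < ε → IsUniqueMaximizing T g.toCont μ

end ErgodicOptimization

/-! ### The symbolic space -/

/-- `a` is a strictly decreasing sequence of positive numbers converging to zero. -/
structure DecreasesToZero (a : ℕ → ℝ) : Prop where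
  pos : ∀ n, 0 < a n
  strictAnti : StrictAnti a
  tendsto : Tendsto a atTop (𝓝 0)

/-- `a` is evanescent: it decreases strictly to zero and `a (n+1) / a n = O(2^(-2^(n+2)))`. -/
structure Evanescent (a : ℕ → ℝ) : Prop where
  decreases : DecreasesToZero a
  ratio : (fun n : ℕ => a (n + 1) / a n) =O[atTop] fun n : ℕ => ((2 : ℝ) ^ (2 ^ (n + 2)))⁻¹

/-- The space `{0,1}^ℕ`, a type synonym that carries the metric `d_a`. -/
def Omega (a : ℕ → ℝ) (_ha : DecreasesToZero a) : Type := ℕ → Fin 2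

namespace Omega

variable {a : ℕ → ℝ} {ha : DecreasesToZero a}

/-- The sequence of symbols of a point. -/
def toSeq (x : Omega a ha) : ℕ → Fin 2 := x

instance : TopologicalSpace (Omega a ha) := inferInstanceAs (TopologicalSpace (ℕ → Fin 2))

instance : CompactSpace (Omega a ha) := inferInstanceAs (CompactSpace (ℕ → Fin 2))

/-- `d_a x y` is `a m`, where `m` is the first disagreement of `x` and `y`, and `0` if `x = y`. -/
instance : Dist (Omega a ha) where
  dist x y := open Classical in
    if x = y then 0 else a (PiNat.firstDiff (E := fun _ => Fin 2) x.toSeq y.toSeq)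

theorem dist_eq (x y : Omega a ha) :
    dist x y = open Classical in
      if x = y then 0 else a (PiNat.firstDiff (E := fun _ => Fin 2) x.toSeq y.toSeq) := rfl

theorem dist_of_ne {x y : Omega a ha} (h : x ≠ y) :
    dist x y = a (PiNat.firstDiff (E := fun _ => Fin 2) x.toSeq y.toSeq) := by
  rw [dist_eq, if_neg h]

theorem dist_self' (x : Omega a ha) : dist x x = 0 := by rw [dist_eq, if_pos rfl]

theorem dist_comm' (x y : Omega a ha) : dist x y = dist y x := by
  by_cases h : x = y
  · rw [h]
  · rw [dist_of_ne h, dist_of_ne (Ne.symm h), PiNat.firstDiff_comm]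

theorem dist_nonneg' (x y : Omega a ha) : 0 ≤ dist x y := by
  by_cases h : x = y
  · rw [h, dist_self']
  · rw [dist_of_ne h]; exact (ha.pos _).le

theorem dist_triangle' (x y z : Omega a ha) : dist x z ≤ dist x y + dist y z := by
  by_cases hxz : x = z
  · rw [hxz, dist_self']
    exact add_nonneg (dist_nonneg' _ _) (dist_nonneg' _ _)
  by_cases hxy : x = y
  · rw [hxy, dist_self', zero_add]
  by_cases hyz : y = z
  · rw [hyz, dist_self', add_zero]
  have h := PiNat.min_firstDiff_le (E := fun _ => Fin 2) x.toSeq y.toSeq z.toSeq hxz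
  have h1 := dist_nonneg' x y
  have h2 := dist_nonneg' y z
  rw [dist_of_ne hxy] at h1 ⊢
  rw [dist_of_ne hyz] at h2 ⊢
  rw [dist_of_ne hxz]
  rcases min_le_iff.mp h with h | h
  · linarith [ha.strictAnti.antitone h]
  · linarith [ha.strictAnti.antitone h]

theorem dist_lt_iff {x y : Omega a ha} (n : ℕ) :
    dist x y < a n ↔ ∀ i ≤ n, x.toSeq i = y.toSeq i := by
  by_cases h : x = y
  · rw [h, dist_self']
    simp [ha.pos n]
  · rw [dist_of_ne h, ha.strictAnti.lt_iff_gt]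
    constructor
    · intro hn i hi
      exact PiNat.apply_eq_of_lt_firstDiff (E := fun _ => Fin 2) (lt_of_le_of_lt hi hn)
    · intro hi
      by_contra! hn
      exact PiNat.apply_firstDiff_ne (E := fun _ => Fin 2) h (hi _ hn)

theorem isOpen_iff_dist (s : Set (Omega a ha)) :
    IsOpen s ↔ ∀ x ∈ s, ∃ ε > 0, ∀ y, dist x y < ε → y ∈ s := by
  have hP := PiNat.isOpen_iff_dist (E := fun _ => Fin 2) s
  refine Iff.trans hP (forall₂_congr fun x _ => ?_)
  constructor
  · rintro ⟨ε, hε, h⟩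
    obtain ⟨n, hn⟩ := exists_pow_lt_of_lt_one hε (show (1 / 2 : ℝ) < 1 by norm_num)
    refine ⟨a n, ha.pos n, fun y hy => h y (lt_of_le_of_lt ?_ hn)⟩
    refine PiNat.mem_cylinder_iff_dist_le.mp (PiNat.mem_cylinder_iff.mpr fun i hi => ?_)
    exact (dist_lt_iff (ha := ha) n).mp hy i hi.le
  · rintro ⟨ε, hε, h⟩
    obtain ⟨n, hn⟩ := (ha.tendsto.eventually (gt_mem_nhds hε)).exists
    refine ⟨(1 / 2) ^ n, by positivity, fun y hy => h y (lt_trans ?_ hn)⟩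
    exact (dist_lt_iff (ha := ha) n).mpr fun i hi =>
      PiNat.apply_eq_of_dist_lt (E := fun _ => Fin 2) hy hi

/-- The metric `d_a`; its topology is, by definition, the product topology. -/
instance : MetricSpace (Omega a ha) :=
  MetricSpace.ofDistTopology dist dist_self' dist_comm' dist_triangle' isOpen_iff_dist
    (fun x y h => by
      by_contra hne
      rw [dist_of_ne hne] at h
      exact (ha.pos _).ne' h)

instance : MeasurableSpace (Omega a ha) := borel _

instance : BorelSpace (Omega a ha) := ⟨rfl⟩

end Omega

/-- The shift map on `{0,1}^ℕ`. -/
def shift (a : ℕ → ℝ) (ha : DecreasesToZero a) : C(Omega a ha, Omega a ha) where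
  toFun x := fun n : ℕ => x.toSeq (n + 1)
  continuous_toFun :=
    continuous_pi (A := fun _ : ℕ => Fin 2) fun n : ℕ =>
      continuous_apply (A := fun _ : ℕ => Fin 2) (n + 1)

/-- The set `L_a` of `d_a`-Lipschitz functions with the locking property for the shift. -/
def lockedSet (a : ℕ → ℝ) (ha : DecreasesToZero a) : Set (CLip (Omega a ha)) :=
  {f | HasLocking (shift a ha) f}

end

noncomputable section

variable {a : ℕ → ℝ} {ha : DecreasesToZero a}

/-! ### Block functions and cycles of the shift -/

namespace Omega

/-! A function of the symbols with index at most `n` is a weight on the edges (words of length `n +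
1`) of the de Bruijn graph whose vertices are the words of length `n`. Cutting out loops shows that
its largest integral is attained on a cycle of length at most `2 ^ n`. It has a gap `δ` at an edge
`w` if the best mean of the cycles through `w` and the best mean of those avoiding `w` differ by at
least `δ`. With a gap at every edge, an optimal simple cycle `c` beats by `δ` each cycle that leaves
the edges of `c`.

A Lipschitz function of norm at most `D` is within `D * a (n + 1)` of such a weight. Hence gaps that
are a large enough multiple of `(D + 1) * a (n + 1)` survive the approximation and all small
Lipschitz perturbations, and the measure on `c` is locked (`integral_le_of_gapAt`,
`hasLocking_of_gapAt`).

Shyness is tested with the random series of indicators of cylinders, over words of all lengths, with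
independent uniform coefficients `t w` in `[0, 1]` and amplitudes `a n / 4 ^ (n + 1)`. Raising `t w`
alone raises the means of the cycles through `w`, by at least `2 ^ (-n)` times the increase of the
coefficient, and leaves the other means unchanged. So the values of `t w` without a gap `δ` form a
set of diameter at most `2 * δ * 2 ^ n * 4 ^ (n + 1) / a n` (`le_of_not_gapAt`). With `δ` of order
`a (n + 1)`, a union bound over the `2 ^ (n + 1)` words makes the probability of failure `O(16 ^ n *
a (n + 1) / a n)`, even after adding a fixed function. Evanescence sends this to zero. -/

theorem shift_iterate_toSeq (k : ℕ) (x : Omega a ha) (i : ℕ) :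
    ((shift a ha)^[k] x).toSeq i = x.toSeq (k + i) := by
  induction k generalizing x with
  | zero => simp
  | succ k ih =>
    rw [Function.iterate_succ_apply, ih]
    change x.toSeq (k + i + 1) = _
    congr 1
    omega

@[ext]
theorem ext {x y : Omega a ha} (h : ∀ i, x.toSeq i = y.toSeq i) : x = y := funext h

/-- The point with a given sequence of symbols. -/
def ofSeq (s : ℕ → Fin 2) : Omega a ha := s

theorem toSeq_ofSeq (s : ℕ → Fin 2) : (ofSeq s : Omega a ha).toSeq = s := rfl

theorem dist_le_of_agree {x y : Omega a ha} {m : ℕ} (h : ∀ i < m, x.toSeq i = y.toSeq i) :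
    dist x y ≤ a m := by
  by_cases hxy : x = y
  · rw [hxy, dist_self]
    exact (ha.pos m).le
  · rw [dist_of_ne hxy]
    refine ha.strictAnti.antitone (not_lt.mp fun hlt => ?_)
    exact PiNat.apply_firstDiff_ne (E := fun _ => Fin 2) hxy (h _ hlt)

/-- `F` depends only on the symbols with index at most `n`. -/
def IsBlock (n : ℕ) (F : Omega a ha → ℝ) : Prop :=
  ∀ x y : Omega a ha, (∀ i ≤ n, x.toSeq i = y.toSeq i) → F x = F y

theorem IsBlock.continuous {n : ℕ} {F : Omega a ha → ℝ} (hF : IsBlock n F) : Continuous F := by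
  refine continuous_iff_continuousAt.mpr fun x => ?_
  refine (continuousAt_const (y := F x)).congr ?_
  filter_upwards [Metric.ball_mem_nhds x (ha.pos n)] with y hy
  refine hF x y fun i hi => ?_
  rw [Metric.mem_ball] at hy
  exact ((dist_lt_iff n).mp hy i hi).symm

/-- Two points with the same symbols up to index `n + M` have the same Birkhoff sums. -/
theorem IsBlock.birkhoffSum_congr {n M : ℕ} {F : Omega a ha → ℝ} (hF : IsBlock n F)
    {x y : Omega a ha} (h : ∀ i < M + n, x.toSeq i = y.toSeq i) :
    birkhoffSum (shift a ha) F M x = birkhoffSum (shift a ha) F M y := by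
  refine Finset.sum_congr rfl fun k hk => hF _ _ fun i hi => ?_
  rw [shift_iterate_toSeq, shift_iterate_toSeq]
  exact h _ (by have := Finset.mem_range.mp hk; omega)

/-- The periodic point that repeats the first `j` symbols of `x`. -/
def periodize (j : ℕ) (x : Omega a ha) : Omega a ha := ofSeq fun i => x.toSeq (i % j)

theorem periodize_toSeq (j : ℕ) (x : Omega a ha) (i : ℕ) :
    (periodize j x).toSeq i = x.toSeq (i % j) := rfl

theorem shift_iterate_periodize (j : ℕ) (x : Omega a ha) :
    (shift a ha)^[j] (periodize j x) = periodize j x := by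
  ext i
  rw [shift_iterate_toSeq, periodize_toSeq, periodize_toSeq, Nat.add_mod_left]

theorem toSeq_mod_of_agree {n j : ℕ} {x : Omega a ha} (hj : 0 < j)
    (h : ∀ m < n, x.toSeq m = x.toSeq (j + m)) :
    ∀ i < j + n, x.toSeq i = x.toSeq (i % j) := by
  intro i
  induction i using Nat.strong_induction_on with
  | _ i ih =>
    intro hi
    rcases lt_or_ge i j with hij | hij
    · rw [Nat.mod_eq_of_lt hij]
    · have h1 := h (i - j) (by omega)
      rw [show j + (i - j) = i by omega] at h1
      rw [← h1, ih (i - j) (by omega) (by omega), Nat.mod_eq_sub_mod hij]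

/-- Equal blocks of length `n` at `0` and `j` make `x` agree with its periodization below index `j +
n`, which is all that `F` sees in `j` steps. So a path that returns to a vertex can be closed into a
cycle without changing its weight. -/
theorem IsBlock.birkhoffSum_periodize {n j : ℕ} {F : Omega a ha → ℝ} (hF : IsBlock n F)
    {x : Omega a ha} (hj : 0 < j) (h : ∀ m < n, x.toSeq m = x.toSeq (j + m)) :
    birkhoffSum (shift a ha) F j x = birkhoffSum (shift a ha) F j (periodize j x) :=
  hF.birkhoffSum_congr fun i hi => toSeq_mod_of_agree hj h i hi

variable (a ha) in
/-- The pairs `(l, x)` such that `l ≤ 2 ^ n` is a period of `x`. -/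
def cycles (n : ℕ) : Set (ℕ × Omega a ha) :=
  {c | 0 < c.1 ∧ c.1 ≤ 2 ^ n ∧ (shift a ha)^[c.1] c.2 = c.2}

theorem toSeq_mod_of_periodic {l : ℕ} {x : Omega a ha} (hx : (shift a ha)^[l] x = x) (i : ℕ) :
    x.toSeq i = x.toSeq (i % l) := by
  induction i using Nat.strong_induction_on with
  | _ i ih =>
    rcases Nat.eq_zero_or_pos l with rfl | hl
    · rw [Nat.mod_zero]
    rcases lt_or_ge i l with h | h
    · rw [Nat.mod_eq_of_lt h]
    · have h1 := shift_iterate_toSeq l x (i - l)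
      rw [hx, show l + (i - l) = i by omega] at h1
      rw [← h1, ih (i - l) (by omega), Nat.mod_eq_sub_mod h]

/-- A cycle is determined by its length and its first `2 ^ n` symbols. -/
theorem finite_cycles (n : ℕ) : (cycles a ha n).Finite := by
  let f : ℕ × Omega a ha → Fin (2 ^ n + 1) × (Fin (2 ^ n) → Fin 2) :=
    fun c => (Fin.ofNat _ c.1, fun i => c.2.toSeq i)
  refine Set.Finite.of_finite_image (f := f) (Set.toFinite _) ?_
  rintro ⟨l, x⟩ ⟨hl, hlN, hx⟩ ⟨l', x'⟩ ⟨hl', hlN', hx'⟩ h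
  dsimp only at hl hlN hx hl' hlN' hx'
  have h1 : l = l' := by
    have h1 := congrArg (fun z => (z.1 : ℕ)) h
    simp only [f, Fin.ofNat] at h1
    rwa [Nat.mod_eq_of_lt (by omega), Nat.mod_eq_of_lt (by omega)] at h1
  subst h1
  have h2 : x = x' := by
    refine Omega.ext fun i => ?_
    have hi : i % l < 2 ^ n := (Nat.mod_lt _ hl).trans_le hlN
    have h2 := congrFun (congrArg Prod.snd h) ⟨i % l, hi⟩
    rw [toSeq_mod_of_periodic hx, toSeq_mod_of_periodic hx']
    exact h2
  rw [h2]

/-- The mean of `f` along a cycle. -/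
def cycleMean (f : Omega a ha → ℝ) (c : ℕ × Omega a ha) : ℝ :=
  birkhoffSum (shift a ha) f c.1 c.2 / c.1

theorem cycleMean_le_iff {f : Omega a ha → ℝ} {c : ℕ × Omega a ha} (hc : 0 < c.1) {β : ℝ} :
    cycleMean f c ≤ β ↔ birkhoffSum (shift a ha) f c.1 c.2 ≤ c.1 * β := by
  rw [cycleMean, div_le_iff₀ (by exact_mod_cast hc), mul_comm]

theorem cycleMean_le_add {f g : Omega a ha → ℝ} {η : ℝ} (h : ∀ x, f x ≤ g x + η)
    {c : ℕ × Omega a ha} (hc : 0 < c.1) : cycleMean f c ≤ cycleMean g c + η := by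
  have hc' : (0 : ℝ) < c.1 := by exact_mod_cast hc
  rw [cycleMean_le_iff hc, cycleMean, mul_add, mul_div_cancel₀ _ hc'.ne']
  calc birkhoffSum (shift a ha) f c.1 c.2
      ≤ ∑ k ∈ Finset.range c.1, (g ((shift a ha)^[k] c.2) + η) :=
        Finset.sum_le_sum fun k _ => h _
    _ = _ := by rw [Finset.sum_add_distrib]; simp [birkhoffSum]

/-- A block function with cycle means at most `β` has Birkhoff sums at most `M * β + O(1)`. -/
theorem IsBlock.birkhoffSum_le {n : ℕ} {F : Omega a ha → ℝ} (hF : IsBlock n F) {β K : ℝ}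
    (hβ : ∀ c ∈ cycles a ha n, cycleMean F c ≤ β) (hK0 : 0 ≤ K) (hK : ∀ x, F x ≤ β + K) (M : ℕ)
    (x : Omega a ha) : birkhoffSum (shift a ha) F M x ≤ M * β + 2 ^ n * K := by
  induction M using Nat.strong_induction_on generalizing x with
  | _ M ih =>
    rcases le_or_gt M (2 ^ n) with hM | hM
    · calc birkhoffSum (shift a ha) F M x ≤ ∑ k ∈ Finset.range M, (β + K) :=
            Finset.sum_le_sum fun k _ => hK _
        _ = M * β + M * K := by simp
        _ ≤ _ := by
          have : (M : ℝ) ≤ 2 ^ n := by exact_mod_cast hM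
          gcongr
    -- Pigeonhole: there are `2 ^ n + 1` starting positions but only `2 ^ n` blocks of length `n`,
    -- so the path revisits a vertex.
    · obtain ⟨i', j', hne', hblk'⟩ := Fintype.exists_ne_map_eq_of_card_lt
        (fun (i : Fin (2 ^ n + 1)) (m : Fin n) => x.toSeq (i + m)) (by simp)
      obtain ⟨i, j, hij, hj, hblk⟩ : ∃ i j : ℕ, i < j ∧ j ≤ 2 ^ n ∧
          ∀ m < n, x.toSeq (i + m) = x.toSeq (j + m) := by
        rcases lt_or_gt_of_ne hne' with h | h
        · exact ⟨i', j', h, by omega, fun m hm => congrFun hblk' ⟨m, hm⟩⟩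
        · exact ⟨j', i', h, by omega, fun m hm => (congrFun hblk' ⟨m, hm⟩).symm⟩
      -- The path with the loop between `i` and `j` cut out; the induction hypothesis applies to it,
      -- and the loop itself closes into a cycle.
      let x' : Omega a ha := ofSeq fun k => if k < i then x.toSeq k else x.toSeq (k + (j - i))
      have hx'1 : ∀ k < i + n, x.toSeq k = x'.toSeq k := by
        intro k hk
        simp only [x', toSeq_ofSeq]
        split_ifs with h
        · rfl
        · have h1 := hblk (k - i) (by omega)
          rwa [show i + (k - i) = k by omega, show j + (k - i) = k + (j - i) by omega] at h1
      have hx'2 : (shift a ha)^[i] x' = (shift a ha)^[j] x := by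
        refine Omega.ext fun k => ?_
        rw [shift_iterate_toSeq, shift_iterate_toSeq]
        simp only [x', toSeq_ofSeq]
        rw [if_neg (by omega)]
        exact congrArg x.toSeq (by omega)
      have hM1 : M = i + ((j - i) + (M - j)) := by omega
      have hsplit : birkhoffSum (shift a ha) F M x = birkhoffSum (shift a ha) F (M - (j - i)) x' +
          birkhoffSum (shift a ha) F (j - i) ((shift a ha)^[i] x) := by
        have e1 : birkhoffSum (shift a ha) F M x = birkhoffSum (shift a ha) F i x +
            (birkhoffSum (shift a ha) F (j - i) ((shift a ha)^[i] x) +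
            birkhoffSum (shift a ha) F (M - j) ((shift a ha)^[j] x)) := by
          conv_lhs => rw [hM1]
          rw [birkhoffSum_add, birkhoffSum_add, ← Function.iterate_add_apply,
            show j - i + i = j by omega]
        have e2 : birkhoffSum (shift a ha) F (M - (j - i)) x' =
            birkhoffSum (shift a ha) F i x' +
            birkhoffSum (shift a ha) F (M - j) ((shift a ha)^[j] x) := by
          rw [show M - (j - i) = i + (M - j) by omega, birkhoffSum_add, hx'2]
        rw [e1, e2, hF.birkhoffSum_congr hx'1]
        ring
      have hloop : birkhoffSum (shift a ha) F (j - i) ((shift a ha)^[i] x) ≤ (j - i : ℕ) * β := by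
        rw [hF.birkhoffSum_periodize (by omega) fun m hm => ?_]
        · exact (cycleMean_le_iff (c := (j - i, _)) (by dsimp only; omega)).mp
            (hβ (j - i, _) ⟨by dsimp only; omega, by dsimp only; omega,
              shift_iterate_periodize _ _⟩)
        · rw [shift_iterate_toSeq, shift_iterate_toSeq, hblk m hm]
          congr 1
          omega
      have hrest := ih (M - (j - i)) (by omega) x'
      have hcast : ((M - (j - i) : ℕ) : ℝ) + (j - i : ℕ) = M := by
        rw [← Nat.cast_add]
        congr 1
        omega
      rw [hsplit, ← hcast]
      linarith

/-! ### Integrals against invariant measures -/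

theorem integrable_of_continuous {μ : Measure (Omega a ha)} [IsProbabilityMeasure μ]
    {f : Omega a ha → ℝ} (hf : Continuous f) : Integrable f μ :=
  hf.integrable_of_hasCompactSupport (HasCompactSupport.of_compactSpace f)

theorem integral_iterate {μ : Measure (Omega a ha)} (hμ : μ ∈ invariantMeasures (shift a ha))
    {f : Omega a ha → ℝ} (hf : Continuous f) (k : ℕ) :
    ∫ x, f ((shift a ha)^[k] x) ∂μ = ∫ x, f x ∂μ := by
  have h := hμ.2.iterate k
  conv_rhs => rw [← h.map_eq]
  rw [integral_map h.measurable.aemeasurable hf.aestronglyMeasurable]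

/-- The integral of a block function is at most its largest cycle mean. -/
theorem IsBlock.integral_le {n : ℕ} {F : Omega a ha → ℝ} (hF : IsBlock n F) {β : ℝ}
    (hβ : ∀ c ∈ cycles a ha n, cycleMean F c ≤ β) {μ : Measure (Omega a ha)}
    (hμ : μ ∈ invariantMeasures (shift a ha)) : ∫ x, F x ∂μ ≤ β := by
  have := hμ.1
  obtain ⟨B, hB⟩ := (isCompact_range hF.continuous).bddAbove
  have hB' : ∀ x, F x ≤ B := fun x => hB ⟨x, rfl⟩
  -- The error term does not depend on `M`, so an integral above `β` would be contradicted by a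
  -- large `M`.
  have hsum : ∀ M : ℕ, M * ∫ x, F x ∂μ ≤ M * β + 2 ^ n * max (B - β) 0 := by
    intro M
    have h1 : ∫ x, birkhoffSum (shift a ha) F M x ∂μ = M * ∫ x, F x ∂μ := by
      simp only [birkhoffSum]
      rw [integral_finsetSum _ fun k _ => integrable_of_continuous
        (f := fun x => F ((shift a ha)^[k] x))
        (hF.continuous.comp ((shift a ha).continuous.iterate k))]
      rw [Finset.sum_congr rfl fun k _ => integral_iterate hμ hF.continuous k]
      simp
    rw [← h1]
    calc ∫ x, birkhoffSum (shift a ha) F M x ∂μ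
        ≤ ∫ _, (M * β + 2 ^ n * max (B - β) 0) ∂μ := by
          refine integral_mono (integrable_of_continuous ?_) (integrable_const _) fun x => ?_
          · exact continuous_finsetSum _ fun k _ =>
              hF.continuous.comp ((shift a ha).continuous.iterate k)
          · exact hF.birkhoffSum_le hβ (le_max_right _ _)
              (fun x => by linarith [hB' x, le_max_left (B - β) 0]) M x
      _ = _ := by simp
  by_contra! hlt
  obtain ⟨M, hM⟩ := exists_nat_gt ((2 ^ n * max (B - β) 0) / (∫ x, F x ∂μ - β))
  rw [div_lt_iff₀ (by linarith)] at hM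
  linarith [hsum M]

end Omega

/-! ### Orbit measures -/

namespace Omega

theorem shift_iterate_mod {l : ℕ} {p : Omega a ha} (hp : (shift a ha)^[l] p = p) (k : ℕ) :
    (shift a ha)^[k % l] p = (shift a ha)^[k] p :=
  Function.IsPeriodicPt.iterate_mod_apply hp k

theorem birkhoffSum_iterate_of_periodic {l : ℕ} {p : Omega a ha} (hp : (shift a ha)^[l] p = p)
    (f : Omega a ha → ℝ) (i : ℕ) :
    birkhoffSum (shift a ha) f l ((shift a ha)^[i] p) = birkhoffSum (shift a ha) f l p := by
  induction i with
  | zero => rfl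
  | succ i ih =>
    rw [Function.iterate_succ_apply', ← ih]
    have h := birkhoffSum_apply_sub_birkhoffSum (shift a ha) f l ((shift a ha)^[i] p)
    have h2 : (shift a ha)^[l] ((shift a ha)^[i] p) = (shift a ha)^[i] p := by
      rw [← Function.iterate_add_apply, add_comm, Function.iterate_add_apply, hp]
    rw [h2, sub_self] at h
    linarith

theorem birkhoffSum_mul_of_periodic {l : ℕ} {p : Omega a ha} (hp : (shift a ha)^[l] p = p)
    (f : Omega a ha → ℝ) (k : ℕ) :
    birkhoffSum (shift a ha) f (l * k) p = k * birkhoffSum (shift a ha) f l p := by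
  induction k with
  | zero => simp
  | succ k ih =>
    rw [Nat.mul_succ, birkhoffSum_add, ih, birkhoffSum_iterate_of_periodic hp]
    push_cast
    ring

/-- The two lengths need not be equal or minimal periods; the sums are compared over the common
period `c.1 * c'.1`. -/
theorem cycleMean_eq_of_orbit {c c' : ℕ × Omega a ha} (hc0 : 0 < c.1) (hc0' : 0 < c'.1)
    (hc : (shift a ha)^[c.1] c.2 = c.2) (hc' : (shift a ha)^[c'.1] c'.2 = c'.2) {i : ℕ}
    (hi : c'.2 = (shift a ha)^[i] c.2) (f : Omega a ha → ℝ) : cycleMean f c' = cycleMean f c := by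
  have h1 := birkhoffSum_mul_of_periodic hc' f c.1
  have h2 : (shift a ha)^[c.1] c'.2 = c'.2 := by
    rw [hi, ← Function.iterate_add_apply, add_comm, Function.iterate_add_apply, hc]
  have h3 := birkhoffSum_mul_of_periodic h2 f c'.1
  have h4 : birkhoffSum (shift a ha) f c.1 c'.2 = birkhoffSum (shift a ha) f c.1 c.2 := by
    rw [hi, birkhoffSum_iterate_of_periodic hc]
  rw [mul_comm, h3, h4] at h1
  rw [cycleMean, cycleMean, div_eq_div_iff (by positivity) (by positivity)]
  linarith

/-- The uniform measure on a cycle. -/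
def orbitMeasure (c : ℕ × Omega a ha) : Measure (Omega a ha) :=
  (c.1 : ENNReal)⁻¹ • ∑ i ∈ Finset.range c.1, Measure.dirac ((shift a ha)^[i] c.2)

theorem isProbabilityMeasure_orbitMeasure {c : ℕ × Omega a ha} (hc0 : 0 < c.1) :
    IsProbabilityMeasure (orbitMeasure c) := by
  constructor
  simp only [orbitMeasure, Measure.smul_apply, Measure.finsetSum_apply, measure_univ,
    Finset.sum_const, Finset.card_range, nsmul_eq_mul, mul_one, smul_eq_mul]
  exact ENNReal.inv_mul_cancel (by exact_mod_cast hc0.ne') (ENNReal.natCast_ne_top _)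

/-- The push-forward moves the index by one: the term `0` is lost and the term `c.1` gained, and
these are the same Dirac mass. -/
theorem orbitMeasure_mem_invariantMeasures {c : ℕ × Omega a ha} (hc0 : 0 < c.1)
    (hc : (shift a ha)^[c.1] c.2 = c.2) : orbitMeasure c ∈ invariantMeasures (shift a ha) := by
  refine ⟨isProbabilityMeasure_orbitMeasure hc0, (shift a ha).continuous.measurable, ?_⟩
  rw [orbitMeasure, Measure.map_smul]
  congr 1
  rw [← Measure.mapₗ_apply_of_measurable (shift a ha).continuous.measurable, map_sum]
  simp only [Measure.mapₗ_apply_of_measurable (shift a ha).continuous.measurable,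
    Measure.map_dirac' (shift a ha).continuous.measurable, ← Function.iterate_succ_apply']
  have h1 := Finset.sum_range_succ (fun i => Measure.dirac ((shift a ha)^[i] c.2)) c.1
  have h2 := Finset.sum_range_succ' (fun i => Measure.dirac ((shift a ha)^[i] c.2)) c.1
  rw [h1, hc] at h2
  ext s hs
  have h3 := congrArg (fun μ : Measure (Omega a ha) => μ s) h2
  simp only [Measure.add_apply, Function.iterate_zero, id] at h3
  exact ((ENNReal.add_left_inj (measure_ne_top _ _)).mp h3).symm

theorem integral_orbitMeasure (c : ℕ × Omega a ha) {f : Omega a ha → ℝ} (hf : Continuous f) :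
    ∫ x, f x ∂(orbitMeasure c) = cycleMean f c := by
  rw [orbitMeasure, integral_smul_measure, integral_finsetSum_measure fun i _ =>
    integrable_of_continuous hf]
  simp only [integral_dirac, ENNReal.toReal_inv, ENNReal.toReal_natCast, smul_eq_mul]
  rw [cycleMean, birkhoffSum, inv_mul_eq_div]

theorem isPeriodicMeasure_orbitMeasure {c : ℕ × Omega a ha} (hc0 : 0 < c.1)
    (hc : (shift a ha)^[c.1] c.2 = c.2) : IsPeriodicMeasure (shift a ha) (orbitMeasure c) := by
  refine ⟨orbitMeasure_mem_invariantMeasures hc0 hc, c.2,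
    Function.mk_mem_periodicPts hc0 hc, ?_⟩
  rw [orbitMeasure, Measure.smul_apply, Measure.finsetSum_apply]
  have : ∀ i ∈ Finset.range c.1, Measure.dirac ((shift a ha)^[i] c.2)
      (Set.range fun n : ℕ => (shift a ha)^[n] c.2)ᶜ = 0 := by
    intro i _
    rw [Measure.dirac_apply' _ (Set.countable_range _).measurableSet.compl]
    simp
  rw [Finset.sum_eq_zero this, smul_zero]

/-- An invariant measure that is concentrated on a cycle is the uniform measure on it. -/
theorem eq_orbitMeasure {c : ℕ × Omega a ha} (hc0 : 0 < c.1) (hc : (shift a ha)^[c.1] c.2 = c.2)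
    {μ : Measure (Omega a ha)} (hμ : μ ∈ invariantMeasures (shift a ha))
    (h : ∀ᵐ x ∂μ, ∃ i, x = (shift a ha)^[i] c.2) : μ = orbitMeasure c := by
  have := hμ.1
  have hmeas := (shift a ha).continuous.measurable
  ext s hs
  have h0 : ∀ k, Measurable fun x => s.indicator (1 : Omega a ha → ENNReal) ((shift a ha)^[k] x) :=
    fun k => (measurable_one.indicator hs).comp (hmeas.iterate k)
  have h1 : ∀ k, ∫⁻ x, s.indicator 1 ((shift a ha)^[k] x) ∂μ = μ s := by
    intro k
    have hk := hμ.2.iterate k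
    rw [hk.lintegral_comp (measurable_one.indicator hs), lintegral_indicator_one hs]
  have h2 : (c.1 : ENNReal) * μ s =
      ∑ i ∈ Finset.range c.1, s.indicator 1 ((shift a ha)^[i] c.2) := by
    -- The sum of the indicator along `c.1` iterates is the same from every point of the cycle,
    -- since one step only moves the first term to the end. By invariance its integral is `c.1 * μ
    -- s`.
    calc (c.1 : ENNReal) * μ s
        = ∫⁻ x, ∑ k ∈ Finset.range c.1, s.indicator 1 ((shift a ha)^[k] x) ∂μ := by
          rw [lintegral_finsetSum _ fun k _ => h0 k]
          simp [h1]
      _ = ∫⁻ _, ∑ i ∈ Finset.range c.1, s.indicator 1 ((shift a ha)^[i] c.2) ∂μ := by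
          refine lintegral_congr_ae ?_
          filter_upwards [h] with x hx
          obtain ⟨i, rfl⟩ := hx
          induction i with
          | zero => rfl
          | succ i ih =>
            rw [← ih]
            have e1 := Finset.sum_range_succ (fun k => s.indicator (1 : Omega a ha → ENNReal)
              ((shift a ha)^[k] ((shift a ha)^[i] c.2))) c.1
            have e2 := Finset.sum_range_succ' (fun k => s.indicator (1 : Omega a ha → ENNReal)
              ((shift a ha)^[k] ((shift a ha)^[i] c.2))) c.1
            have e3 : (shift a ha)^[c.1] ((shift a ha)^[i] c.2) = (shift a ha)^[i] c.2 := by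
              rw [← Function.iterate_add_apply, add_comm, Function.iterate_add_apply, hc]
            rw [e1, e3, Function.iterate_zero, id] at e2
            have e4 : s.indicator (1 : Omega a ha → ENNReal) ((shift a ha)^[i] c.2) ≠ ⊤ := by
              by_cases hs : (shift a ha)^[i] c.2 ∈ s <;> simp [hs]
            rw [(ENNReal.add_left_inj e4).mp e2]
            refine Finset.sum_congr rfl fun k _ => ?_
            rw [← Function.iterate_add_apply, ← Function.iterate_add_apply]
            congr 2
            omega
      _ = _ := by simp
  rw [orbitMeasure, Measure.smul_apply, Measure.finsetSum_apply, smul_eq_mul]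
  simp only [Measure.dirac_apply' _ hs]
  rw [← h2, ← mul_assoc, ENNReal.inv_mul_cancel (by exact_mod_cast hc0.ne')
    (ENNReal.natCast_ne_top _), one_mul]

end Omega

/-! ### Isolated cycles have the locking property -/

namespace Omega

/-- No two points of the cycle start with the same block of length `n`. -/
def IsSimple (n : ℕ) (c : ℕ × Omega a ha) : Prop :=
  ∀ i < c.1, ∀ j < c.1, (∀ m < n, c.2.toSeq (i + m) = c.2.toSeq (j + m)) → i = j

/-- The first `n + 1` symbols of `x` are those of the point number `i` of the cycle `c`. -/
def Follows (n : ℕ) (c : ℕ × Omega a ha) (x : Omega a ha) (i : ℕ) : Prop :=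
  i < c.1 ∧ ∀ m ≤ n, x.toSeq m = c.2.toSeq (i + m)

/-- The cycle `c` visits the cylinder of the word `w`. -/
def Visits {n : ℕ} (w : Fin (n + 1) → Fin 2) (c : ℕ × Omega a ha) : Prop :=
  ∃ k < c.1, ∀ m : Fin (n + 1), c.2.toSeq (k + m) = w m

/-- The largest mean of `f` along the cycles that visit `w`, and the largest one along those that
do not, differ by at least `δ`. -/
def GapAt {n : ℕ} (δ : ℝ) (f : Omega a ha → ℝ) (w : Fin (n + 1) → Fin 2) : Prop :=
  (∃ c ∈ cycles a ha n, Visits w c ∧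
    ∀ c' ∈ cycles a ha n, ¬ Visits w c' → cycleMean f c' + δ ≤ cycleMean f c) ∨
  (∃ c ∈ cycles a ha n, ¬ Visits w c ∧
    ∀ c' ∈ cycles a ha n, Visits w c' → cycleMean f c' + δ ≤ cycleMean f c)

theorem GapAt.of_abs_sub_le {n : ℕ} {δ η : ℝ} {f g : Omega a ha → ℝ} {w : Fin (n + 1) → Fin 2}
    (h : GapAt δ f w) (hfg : ∀ x, |f x - g x| ≤ η) : GapAt (δ - 2 * η) g w := by
  have h1 : ∀ c ∈ cycles a ha n, cycleMean f c ≤ cycleMean g c + η := fun c hc =>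
    cycleMean_le_add (fun x => by linarith [(abs_le.mp (hfg x)).2]) hc.1
  have h2 : ∀ c ∈ cycles a ha n, cycleMean g c ≤ cycleMean f c + η := fun c hc =>
    cycleMean_le_add (fun x => by linarith [(abs_le.mp (hfg x)).1]) hc.1
  rcases h with ⟨c, hc, hv, h⟩ | ⟨c, hc, hv, h⟩
  · exact Or.inl ⟨c, hc, hv, fun c' hc' hv' => by
      linarith [h c' hc' hv', h1 c hc, h2 c' hc']⟩
  · exact Or.inr ⟨c, hc, hv, fun c' hc' hv' => by
      linarith [h c' hc' hv', h1 c hc, h2 c' hc']⟩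

/-- The fixed point with all symbols equal to `s`, as a cycle. -/
def constCycle (s : Fin 2) : ℕ × Omega a ha := (1, ofSeq fun _ => s)

theorem constCycle_mem (n : ℕ) (s : Fin 2) : constCycle s ∈ cycles a ha n :=
  ⟨Nat.one_pos, Nat.one_le_two_pow, rfl⟩

/-- A block function is maximized by some simple cycle. -/
theorem IsBlock.exists_isSimple {n : ℕ} {F : Omega a ha → ℝ} (hF : IsBlock n F) :
    ∃ c ∈ cycles a ha n, IsSimple n c ∧ ∀ c' ∈ cycles a ha n, cycleMean F c' ≤ cycleMean F c := by
  obtain ⟨c₀, hc₀, hmax⟩ := Set.exists_max_image _ (cycleMean F) (finite_cycles (ha := ha) n)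
    ⟨_, constCycle_mem n 0⟩
  -- A shortest cycle among the optimal ones. If it repeated a block, it would split there into two
  -- shorter cycles, whose means are strictly below the optimum by minimality of the length.
  obtain ⟨c, ⟨hc, hcβ⟩, hmin⟩ := Set.exists_min_image
    {c | c ∈ cycles a ha n ∧ cycleMean F c = cycleMean F c₀} Prod.fst
    ((finite_cycles n).subset fun c hc => hc.1) ⟨c₀, hc₀, rfl⟩
  refine ⟨c, hc, ?_, fun c' hc' => hcβ ▸ hmax c' hc'⟩
  have key : ∀ i j, i < j → j < c.1 → ¬ ∀ m < n, c.2.toSeq (i + m) = c.2.toSeq (j + m) := by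
    intro i j hij hj hblk
    obtain ⟨l, p⟩ := c
    dsimp only at hj hblk
    obtain ⟨hl, hlN, hp⟩ := hc
    dsimp only at hl hlN hp
    have hq : (shift a ha)^[l] ((shift a ha)^[i] p) = (shift a ha)^[i] p := by
      rw [← Function.iterate_add_apply, add_comm, Function.iterate_add_apply, hp]
    have hqsum := birkhoffSum_iterate_of_periodic hp F i
    set q := (shift a ha)^[i] p with hqdef
    set k := j - i with hk
    have hqblk : ∀ m < n, q.toSeq m = q.toSeq (k + m) := by
      intro m hm
      rw [hqdef, shift_iterate_toSeq, shift_iterate_toSeq, hblk m hm]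
      exact congrArg p.toSeq (by omega)
    have hq' : ∀ m < n, ((shift a ha)^[k] q).toSeq m = ((shift a ha)^[k] q).toSeq (l - k + m) := by
      intro m hm
      rw [shift_iterate_toSeq k q, shift_iterate_toSeq k q, ← hqblk m hm,
        show k + (l - k + m) = l + m by omega, ← shift_iterate_toSeq l q, hq]
    have hsum : birkhoffSum (shift a ha) F l p =
        birkhoffSum (shift a ha) F k (periodize k q) +
        birkhoffSum (shift a ha) F (l - k) (periodize (l - k) ((shift a ha)^[k] q)) := by
      rw [← hqsum, ← hF.birkhoffSum_periodize (by omega) hqblk,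
        ← hF.birkhoffSum_periodize (by omega) hq', ← birkhoffSum_add,
        show k + (l - k) = l by omega]
    have hlt : ∀ (m : ℕ) (y : Omega a ha), 0 < m → m < l →
        birkhoffSum (shift a ha) F m (periodize m y) < m * cycleMean F c₀ := by
      intro m y hm hml
      have hmem : (m, periodize m y) ∈ cycles a ha n :=
        ⟨hm, hml.le.trans hlN, shift_iterate_periodize m y⟩
      refine lt_of_le_of_ne ((cycleMean_le_iff (c := (m, periodize m y)) hm).mp (hmax _ hmem))
        fun heq => ?_
      have h1 := hmin (m, periodize m y) ⟨hmem, by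
        rw [cycleMean, heq, mul_div_cancel_left₀]
        exact_mod_cast hm.ne'⟩
      dsimp only at h1
      omega
    have h1 := hlt k q (by omega) (by omega)
    have h2 := hlt (l - k) ((shift a ha)^[k] q) (by omega) (by omega)
    have h3 : birkhoffSum (shift a ha) F l p = l * cycleMean F c₀ := by
      rw [← hcβ, cycleMean, mul_div_cancel₀]
      exact_mod_cast hl.ne'
    have hcast : (k : ℝ) + (l - k : ℕ) = l := by
      rw [← Nat.cast_add]
      congr 1
      omega
    rw [hsum, ← hcast] at h3
    linarith
  intro i hi j hj h
  rcases lt_trichotomy i j with hlt | heq | hgt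
  · exact absurd h (key i j hlt hj)
  · exact heq
  · exact absurd (fun m hm => (h m hm).symm) (key j i hgt hi)

/-! ### Orbits that stay in the blocks of a simple cycle -/

theorem Follows.unique {n : ℕ} {c : ℕ × Omega a ha} (hs : IsSimple n c) {x : Omega a ha}
    {i j : ℕ} (hi : Follows n c x i) (hj : Follows n c x j) : i = j :=
  hs i hi.1 j hj.1 fun m hm => by rw [← hi.2 m hm.le, hj.2 m hm.le]

theorem follows_congr {n : ℕ} {c : ℕ × Omega a ha} {x y : Omega a ha}
    (h : ∀ i ≤ n, x.toSeq i = y.toSeq i) (i : ℕ) : Follows n c x i ↔ Follows n c y i :=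
  and_congr_right fun _ => forall₂_congr fun m hm => by rw [h m hm]

theorem toSeq_mod_add {l : ℕ} {p : Omega a ha} (hp : (shift a ha)^[l] p = p) (i m : ℕ) :
    p.toSeq (i % l + m) = p.toSeq (i + m) := by
  rw [← shift_iterate_toSeq, ← shift_iterate_toSeq, shift_iterate_mod hp]

/-- If `x` agrees with a point of a simple cycle at the `n` indices before `k`, and if its block
at `k - n` occurs in the cycle, then `x` agrees with that point at `k` too. -/
theorem eq_of_follows {n : ℕ} {c : ℕ × Omega a ha} (hc0 : 0 < c.1)
    (hc : (shift a ha)^[c.1] c.2 = c.2) (hs : IsSimple n c) {x : Omega a ha} {i k : ℕ}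
    (h : ∀ m < n, x.toSeq (k + m) = c.2.toSeq (i + k + m))
    (hf : ∃ j, Follows n c ((shift a ha)^[k] x) j) :
    x.toSeq (k + n) = c.2.toSeq (i + k + n) := by
  obtain ⟨j, hj, hjm⟩ := hf
  have h1 : j = (i + k) % c.1 := by
    refine hs j hj _ (Nat.mod_lt _ hc0) fun m hm => ?_
    rw [toSeq_mod_add hc, ← h m hm, ← hjm m hm.le, shift_iterate_toSeq]
  rw [← shift_iterate_toSeq, hjm n le_rfl, h1, toSeq_mod_add hc]

/-- The first block selects a point of the cycle. Each later block must then continue it, because in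
a simple cycle `n` symbols determine the next one. -/
theorem eq_iterate_of_forall_follows {n : ℕ} {c : ℕ × Omega a ha} (hc0 : 0 < c.1)
    (hc : (shift a ha)^[c.1] c.2 = c.2) (hs : IsSimple n c) {x : Omega a ha}
    (hf : ∀ k, ∃ j, Follows n c ((shift a ha)^[k] x) j) :
    ∃ i, x = (shift a ha)^[i] c.2 := by
  obtain ⟨i, hi, him⟩ := hf 0
  refine ⟨i, Omega.ext fun k => ?_⟩
  rw [shift_iterate_toSeq]
  induction k using Nat.strong_induction_on with
  | _ k ih =>
    rcases le_or_gt k n with hk | hk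
    · exact him k hk
    · have h := eq_of_follows (i := i) (k := k - n) hc0 hc hs (fun m hm => ?_) (hf (k - n))
      · rw [show k - n + n = k by omega, show i + (k - n) + n = i + k by omega] at h
        exact h
      · rw [ih _ (by omega)]
        exact congrArg c.2.toSeq (by omega)

/-- If a block function has gaps at all words, then the cycles that leave the blocks of an optimal
cycle have a mean that is smaller by at least the gap. -/
theorem cycleMean_add_le_of_gapAt {n : ℕ} {δ : ℝ} (hδ : 0 < δ) {F : Omega a ha → ℝ}
    (hgap : ∀ w : Fin (n + 1) → Fin 2, GapAt δ F w) {c : ℕ × Omega a ha}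
    (hc : c ∈ cycles a ha n) (hmax : ∀ c' ∈ cycles a ha n, cycleMean F c' ≤ cycleMean F c)
    {c' : ℕ × Omega a ha} (hc' : c' ∈ cycles a ha n) {k : ℕ}
    (hk : ¬ ∃ j, Follows n c ((shift a ha)^[k] c'.2) j) :
    cycleMean F c' + δ ≤ cycleMean F c := by
  let w : Fin (n + 1) → Fin 2 := fun m => c'.2.toSeq (k + m)
  have hw' : Visits w c' :=
    ⟨k % c'.1, Nat.mod_lt _ hc'.1, fun m => toSeq_mod_add hc'.2.2 k m⟩
  have hw : ¬ Visits w c := by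
    rintro ⟨j, hj, hjm⟩
    exact hk ⟨j, hj, fun m hm => by
      rw [shift_iterate_toSeq, hjm ⟨m, by omega⟩]⟩
  -- The optimal cycle avoids `w`, so the cycles through `w` cannot be ahead by a positive `δ`.
  -- Hence those avoiding `w` are ahead, and `c'` is among the losers.
  rcases hgap w with ⟨c₁, hc₁, -, h⟩ | ⟨c₁, hc₁, -, h⟩
  · linarith [h c hc hw, hmax c₁ hc₁]
  · linarith [h c' hc' hw', hmax c₁ hc₁]

/-- The indicator function of the points whose first block does not occur in the cycle `c`. -/
def offCycle (n : ℕ) (c : ℕ × Omega a ha) (x : Omega a ha) : ℝ :=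
  open Classical in if ∃ i, Follows n c x i then 0 else 1

theorem offCycle_nonneg (n : ℕ) (c : ℕ × Omega a ha) (x : Omega a ha) : 0 ≤ offCycle n c x := by
  rw [offCycle]
  split_ifs <;> norm_num

theorem isBlock_offCycle (n : ℕ) (c : ℕ × Omega a ha) : IsBlock n (offCycle n c) := by
  intro x y h
  classical
  exact if_congr (exists_congr (follows_congr h)) rfl rfl

/-- Keeping the term `2 * a (n + K)` on the left makes the geometric estimate pass through the
induction. -/
theorem sum_add_le_two_mul {n : ℕ} (hn : ∀ j ≥ n, a (j + 1) ≤ a j / 2) (K : ℕ) :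
    ∑ k ∈ Finset.range K, a (n + k) + 2 * a (n + K) ≤ 2 * a n := by
  induction K with
  | zero => simp
  | succ K ih =>
    have h := hn (n + K) (by omega)
    rw [Finset.sum_range_succ, ← add_assoc]
    linarith

/-- The integral of a Lipschitz function that is close to a block function with gaps is largest on
an optimal simple cycle, with a loss for the mass outside the blocks of that cycle. -/
theorem integral_le_of_gapAt {n : ℕ} (hn : ∀ j ≥ n + 1, a (j + 1) ≤ a j / 2) {δ η L : ℝ}
    {F g : Omega a ha → ℝ} (hF : IsBlock n F) (hgap : ∀ w : Fin (n + 1) → Fin 2, GapAt δ F w)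
    {c : ℕ × Omega a ha} (hc : c ∈ cycles a ha n) (hs : IsSimple n c)
    (hmax : ∀ c' ∈ cycles a ha n, cycleMean F c' ≤ cycleMean F c)
    (hL0 : 0 ≤ L) (hL : ∀ x y, |g x - g y| ≤ L * dist x y) (hg : Continuous g)
    (hη : ∀ x, |g x - F x| ≤ η) (hδ : 0 < δ) (hδη : 2 * η ≤ δ) {μ : Measure (Omega a ha)}
    (hμ : μ ∈ invariantMeasures (shift a ha)) :
    ∫ x, g x ∂μ ≤
      cycleMean g c - (δ - 2 * η - 2 * L * a (n + 1)) * ∫ x, offCycle n c x ∂μ := by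
  classical
  have := hμ.1
  have hη0 : 0 ≤ η := (abs_nonneg _).trans (hη c.2)
  -- A block function that replaces `g` by its exact values at the points of `c`. Off the blocks of
  -- `c` it exceeds `F` by `δ - η`, which is as much as the gap allows without creating a cycle
  -- better than `c`.
  let G : Omega a ha → ℝ := fun x =>
    if h : ∃ i, Follows n c x i then g ((shift a ha)^[h.choose] c.2) else F x + (δ - η)
  have hGon : ∀ {x i}, Follows n c x i → G x = g ((shift a ha)^[i] c.2) := by
    intro x i h
    have h' : ∃ i, Follows n c x i := ⟨i, h⟩
    simp only [G, dif_pos h']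
    rw [Follows.unique hs h'.choose_spec h]
  have hGoff : ∀ {x}, (¬ ∃ i, Follows n c x i) → G x = F x + (δ - η) := fun h => dif_neg h
  have hGblock : IsBlock n G := by
    intro x y h
    by_cases hx : ∃ i, Follows n c x i
    · obtain ⟨i, hi⟩ := hx
      rw [hGon hi, hGon ((follows_congr h i).mp hi)]
    · rw [hGoff hx, hGoff (by simpa only [← follows_congr h] using hx), hF x y h]
  have hGle : ∀ x, G x ≤ F x + (δ - η) := by
    intro x
    by_cases hx : ∃ i, Follows n c x i
    · obtain ⟨i, hi⟩ := hx
      rw [hGon hi, hF x ((shift a ha)^[i] c.2) fun m hm => by rw [shift_iterate_toSeq, hi.2 m hm]]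
      linarith [(abs_le.mp (hη ((shift a ha)^[i] c.2))).2]
    · rw [hGoff hx]
  -- A cycle that stays in the blocks of `c` lies on its orbit. Any other one loses `δ` for `F`,
  -- regains at most `δ - η` from `G`, and the remaining `η` pays for passing from `F` to `g` on
  -- `c`.
  have hGmean : ∀ c' ∈ cycles a ha n, cycleMean G c' ≤ cycleMean g c := by
    intro c' hc'
    by_cases hf : ∀ k, ∃ j, Follows n c ((shift a ha)^[k] c'.2) j
    · obtain ⟨i, hi⟩ := eq_iterate_of_forall_follows hc.1 hc.2.2 hs hf
      rw [← cycleMean_eq_of_orbit hc.1 hc'.1 hc.2.2 hc'.2.2 hi g]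
      refine le_of_eq ?_
      rw [cycleMean, cycleMean]
      congr 1
      refine Finset.sum_congr rfl fun k _ => ?_
      have hfk : Follows n c ((shift a ha)^[k] c'.2) ((k + i) % c.1) :=
        ⟨Nat.mod_lt _ hc.1, fun m _ => by
          rw [hi, ← Function.iterate_add_apply, shift_iterate_toSeq, toSeq_mod_add hc.2.2]⟩
      rw [hGon hfk, shift_iterate_mod hc.2.2, hi, ← Function.iterate_add_apply]
    · push Not at hf
      obtain ⟨k, hk⟩ := hf
      have h1 := cycleMean_add_le_of_gapAt hδ hgap hc hmax hc' (k := k) (by simpa using hk)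
      have h2 := cycleMean_le_add hGle hc'.1
      have h3 := cycleMean_le_add (f := F) (g := g) (η := η)
        (fun x => by linarith [(abs_le.mp (hη x)).1]) hc.1
      linarith
  have hGint := hGblock.integral_le hGmean hμ
  have hoffblock := isBlock_offCycle n c
  -- A point in a block of `c` shadows a point of `c` until a first disagreement, at some index `n +
  -- 1 + k`. The error `L * a (n + 1 + k)` is charged to the visit off the blocks of `c` at time `k
  -- + 1`; disagreements after the first `K` possible indices go into the last term. Off the blocks
  -- of `c`, the definition of `G` leaves the gain `δ - 2 * η`.
  have hpt : ∀ (K : ℕ) (x : Omega a ha), g x ≤ G x + (2 * η - δ) * offCycle n c x +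
      ∑ k ∈ Finset.range K, L * a (n + 1 + k) * offCycle n c ((shift a ha)^[k + 1] x) +
      L * a (n + 1 + K) := by
    intro K x
    have hterm : ∀ k ∈ Finset.range K,
        0 ≤ L * a (n + 1 + k) * offCycle n c ((shift a ha)^[k + 1] x) := fun k _ =>
      mul_nonneg (mul_nonneg hL0 (ha.pos _).le) (offCycle_nonneg n c _)
    have hsum := Finset.sum_nonneg hterm
    have hlast : 0 ≤ L * a (n + 1 + K) := mul_nonneg hL0 (ha.pos _).le
    by_cases hx : ∃ i, Follows n c x i
    · have hoff : offCycle n c x = 0 := if_pos hx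
      obtain ⟨i, hi⟩ := hx
      rw [hGon hi, hoff, mul_zero, add_zero]
      set q := (shift a ha)^[i] c.2 with hq
      have hgq := (abs_le.mp (hL x q)).2
      by_cases hxq : ∀ m, x.toSeq m = q.toSeq m
      · rw [show x = q from Omega.ext hxq, dist_self] at hgq
        rw [show x = q from Omega.ext hxq] at hsum ⊢
        linarith
      · push Not at hxq
        have hspec := Nat.find_spec hxq
        have hmin : ∀ m < Nat.find hxq, x.toSeq m = q.toSeq m := fun m hm => by
          simpa using Nat.find_min hxq hm
        set k := Nat.find hxq with hkdef
        have hkn : n < k := by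
          by_contra! hle
          exact hspec (by rw [hq, shift_iterate_toSeq, hi.2 k hle])
        have hdist : L * dist x q ≤ L * a k :=
          mul_le_mul_of_nonneg_left (dist_le_of_agree hmin) hL0
        rcases lt_or_ge k (n + 1 + K) with hkK | hkK
        -- The block at `k - n` ends exactly at the first disagreement `k`. If it occurred in `c`,
        -- its first `n` symbols would force agreement at `k`.
        · have hoff' : offCycle n c ((shift a ha)^[k - n - 1 + 1] x) = 1 := by
            refine if_neg fun hf => hspec ?_
            rw [show k - n - 1 + 1 = k - n by omega] at hf
            have h := eq_of_follows (i := i) hc.1 hc.2.2 hs (fun m hm => ?_) hf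
            · rw [show k - n + n = k by omega, show i + (k - n) + n = i + k by omega] at h
              rw [h, hq, shift_iterate_toSeq]
            · rw [hmin _ (by omega), hq, shift_iterate_toSeq]
              exact congrArg c.2.toSeq (by omega)
          have h1 := Finset.single_le_sum hterm (Finset.mem_range.mpr
            (show k - n - 1 < K by omega))
          rw [hoff', mul_one, show n + 1 + (k - n - 1) = k by omega] at h1
          linarith
        · have h1 : L * a k ≤ L * a (n + 1 + K) :=
            mul_le_mul_of_nonneg_left (ha.strictAnti.antitone hkK) hL0
          linarith
    · have hoff : offCycle n c x = 1 := if_neg hx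
      rw [hGoff hx, hoff]
      linarith [(abs_le.mp (hη x)).2]
  set κ := ∫ x, offCycle n c x ∂μ with hκ
  have hκ0 : 0 ≤ κ := integral_nonneg (offCycle_nonneg n c)
  have hK : ∀ K : ℕ, ∫ x, g x ∂μ ≤ cycleMean g c + (2 * η - δ) * κ + 2 * L * a (n + 1) * κ +
      L * a (n + 1 + K) := by
    intro K
    have hcontk : ∀ k, Continuous fun x =>
        L * a (n + 1 + k) * offCycle n c ((shift a ha)^[k + 1] x) := fun k =>
      continuous_const.mul (hoffblock.continuous.comp ((shift a ha).continuous.iterate (k + 1)))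
    have hcont1 : Continuous fun x => (2 * η - δ) * offCycle n c x :=
      continuous_const.mul hoffblock.continuous
    have hcont2 : Continuous fun x => ∑ k ∈ Finset.range K,
        L * a (n + 1 + k) * offCycle n c ((shift a ha)^[k + 1] x) :=
      continuous_finsetSum _ fun k _ => hcontk k
    have hmono := integral_mono (μ := μ) (integrable_of_continuous hg)
      (integrable_of_continuous (((hGblock.continuous.add hcont1).add hcont2).add
        continuous_const)) (hpt K)
    rw [integral_add' (integrable_of_continuous ((hGblock.continuous.add hcont1).add hcont2))
        (integrable_const _),
      integral_add' (integrable_of_continuous (hGblock.continuous.add hcont1))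
        (integrable_of_continuous hcont2),
      integral_add' (integrable_of_continuous hGblock.continuous)
        (integrable_of_continuous hcont1),
      integral_const_mul, integral_finsetSum _ fun k _ => integrable_of_continuous (hcontk k),
      Finset.sum_congr rfl fun k _ => by
        rw [integral_const_mul, integral_iterate hμ hoffblock.continuous, ← hκ],
      ← Finset.sum_mul, ← Finset.mul_sum, integral_const] at hmono
    simp only [probReal_univ, smul_eq_mul, one_mul] at hmono
    have hsum := sum_add_le_two_mul (n := n + 1) hn K
    have hsum' : ∑ k ∈ Finset.range K, a (n + 1 + k) ≤ 2 * a (n + 1) := by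
      linarith [ha.pos (n + 1 + K)]
    have := mul_le_mul_of_nonneg_right (mul_le_mul_of_nonneg_left hsum' hL0) hκ0
    linarith
  -- The truncation error vanishes as `K` tends to infinity.
  have hlim : Tendsto (fun K : ℕ => cycleMean g c + (2 * η - δ) * κ + 2 * L * a (n + 1) * κ +
      L * a (n + 1 + K)) atTop
      (𝓝 (cycleMean g c + (2 * η - δ) * κ + 2 * L * a (n + 1) * κ + L * 0)) :=
    tendsto_const_nhds.add ((ha.tendsto.comp
      (tendsto_atTop_mono (fun K => Nat.le_add_left K (n + 1)) tendsto_id)).const_mul L)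
  have := ge_of_tendsto' hlim hK
  linarith

/-- The coefficient of the off-cycle mass is now strictly negative, so a maximizing measure has no
such mass. By invariance almost every orbit stays in the blocks of `c` and hence lies on `c`. The
cycle is chosen from `F` alone, so it serves all `g` near `F`: this is the source of locking. -/
theorem isUniqueMaximizing_of_gapAt {n : ℕ} (hn : ∀ j ≥ n + 1, a (j + 1) ≤ a j / 2) {δ η L : ℝ}
    {F : Omega a ha → ℝ} {g : C(Omega a ha, ℝ)} (hF : IsBlock n F)
    (hgap : ∀ w : Fin (n + 1) → Fin 2, GapAt δ F w)
    {c : ℕ × Omega a ha} (hc : c ∈ cycles a ha n) (hs : IsSimple n c)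
    (hmax : ∀ c' ∈ cycles a ha n, cycleMean F c' ≤ cycleMean F c)
    (hL0 : 0 ≤ L) (hL : ∀ x y, |g x - g y| ≤ L * dist x y)
    (hη : ∀ x, |g x - F x| ≤ η) (hδ : 2 * η + 2 * L * a (n + 1) < δ) :
    IsUniqueMaximizing (shift a ha) g (orbitMeasure c) := by
  have hη0 : 0 ≤ η := (abs_nonneg _).trans (hη c.2)
  have hLa : 0 ≤ L * a (n + 1) := mul_nonneg hL0 (ha.pos _).le
  have hle : ∀ μ ∈ invariantMeasures (shift a ha), ∫ x, g x ∂μ ≤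
      cycleMean g c - (δ - 2 * η - 2 * L * a (n + 1)) * ∫ x, offCycle n c x ∂μ := fun μ hμ =>
    integral_le_of_gapAt hn hF hgap hc hs hmax hL0 hL g.continuous hη (by linarith) (by linarith)
      hμ
  have hκ0 : ∀ μ : Measure (Omega a ha), 0 ≤ ∫ x, offCycle n c x ∂μ := fun μ =>
    integral_nonneg (offCycle_nonneg n c)
  have horb := orbitMeasure_mem_invariantMeasures hc.1 hc.2.2
  have hsup : ergSup (shift a ha) g = cycleMean g c := by
    refine IsGreatest.csSup_eq ⟨⟨_, horb, integral_orbitMeasure c g.continuous⟩, ?_⟩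
    rintro _ ⟨μ, hμ, rfl⟩
    have := mul_nonneg (show 0 ≤ δ - 2 * η - 2 * L * a (n + 1) by linarith) (hκ0 μ)
    have := hle μ hμ
    dsimp only
    linarith
  refine ⟨⟨horb, by rw [hsup, integral_orbitMeasure c g.continuous]⟩, fun μ hμ => ?_⟩
  have := hμ.1.1
  have hκ : ∫ x, offCycle n c x ∂μ = 0 := by
    have h1 := hle μ hμ.1
    rw [hμ.2, hsup] at h1
    have h2 : (δ - 2 * η - 2 * L * a (n + 1)) * ∫ x, offCycle n c x ∂μ ≤ 0 := by linarith
    exact le_antisymm (nonpos_of_mul_nonpos_right h2 (by linarith)) (hκ0 μ)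
  refine eq_orbitMeasure hc.1 hc.2.2 hμ.1 ?_
  have hae : ∀ k : ℕ, ∀ᵐ x ∂μ, offCycle n c ((shift a ha)^[k] x) = 0 := by
    intro k
    have hcont : Continuous fun x => offCycle n c ((shift a ha)^[k] x) :=
      (isBlock_offCycle n c).continuous.comp ((shift a ha).continuous.iterate k)
    refine (integral_eq_zero_iff_of_nonneg (fun x => offCycle_nonneg n c _)
      (integrable_of_continuous hcont)).mp ?_
    rw [integral_iterate hμ.1 (isBlock_offCycle n c).continuous, hκ]
  filter_upwards [ae_all_iff.mpr hae] with x hx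
  refine eq_iterate_of_forall_follows hc.1 hc.2.2 hs fun k => ?_
  by_contra hk
  have h := hx k
  rw [offCycle, if_neg hk] at h
  exact one_ne_zero h

end Omega

/-! ### Estimating measures on a cube one coordinate at a time -/

section Cube

variable {ι : Type*} [DecidableEq ι]

/-- Resampling one coordinate independently preserves the product measure, as is seen on boxes. With
Fubini this reduces measure bounds to sections in one direction. -/
theorem map_update_infinitePi {X : Type*} [MeasurableSpace X] (ν : Measure X)
    [IsProbabilityMeasure ν] (e : ι) :
    ((Measure.infinitePi fun _ : ι => ν).prod ν).map (fun z => Function.update z.1 e z.2) =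
      Measure.infinitePi fun _ : ι => ν := by
  refine Measure.eq_infinitePi _ fun F t ht => ?_
  have hpre : (fun z : (ι → X) × X => Function.update z.1 e z.2) ⁻¹' (Set.pi F t) =
      Set.pi (F.erase e : Finset ι) t ×ˢ (if e ∈ F then t e else Set.univ) := by
    ext ⟨x, s⟩
    simp only [Set.mem_preimage, Set.mem_pi, Set.mem_prod, Finset.mem_coe, Finset.mem_erase]
    constructor
    · intro h
      refine ⟨fun i hi => ?_, ?_⟩
      · simpa [Function.update_of_ne hi.1] using h i hi.2
      · split_ifs with he
        · simpa using h e he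
        · trivial
    · rintro ⟨h1, h2⟩ i hi
      by_cases hie : i = e
      · subst hie
        rw [if_pos hi] at h2
        simpa using h2
      · rw [Function.update_of_ne hie]
        exact h1 i ⟨hie, hi⟩
  rw [Measure.map_apply measurable_update' (.pi F.countable_toSet fun i _ => ht i), hpre,
    Measure.prod_prod, Measure.infinitePi_pi _ fun i _ => ht i]
  split_ifs with he
  · exact Finset.prod_erase_mul F (fun i => ν (t i)) he
  · rw [Finset.erase_eq_of_notMem he, measure_univ, mul_one]

/-- A measurable subset of the cube whose sections in one direction have diameter at most `r` has
measure at most `r`. -/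
theorem infinitePi_unitInterval_le {B : Set (ι → unitInterval)} (hB : MeasurableSet B) (e : ι)
    {r : ℝ} (h : ∀ x s s', Function.update x e s ∈ B → Function.update x e s' ∈ B →
      (s' : ℝ) - s ≤ r) :
    (Measure.infinitePi fun _ : ι => (volume : Measure unitInterval)) B ≤ ENNReal.ofReal r := by
  rw [← map_update_infinitePi (volume : Measure unitInterval) e,
    Measure.map_apply measurable_update' hB, Measure.prod_apply (measurable_update' hB)]
  have hsec : ∀ x : ι → unitInterval, volume (Prod.mk x ⁻¹'
      ((fun z : (ι → unitInterval) × unitInterval => Function.update z.1 e z.2) ⁻¹' B)) ≤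
      ENNReal.ofReal r := by
    intro x
    rw [unitInterval.volume_apply]
    refine (Real.volume_le_diam _).trans (Metric.ediam_le ?_)
    rintro _ ⟨s, hs, rfl⟩ _ ⟨s', hs', rfl⟩
    rw [edist_dist, Real.dist_eq]
    exact ENNReal.ofReal_le_ofReal (abs_sub_le_iff.mpr ⟨h x s' s hs' hs, h x s s' hs hs'⟩)
  refine (lintegral_mono hsec).trans ?_
  simp

end Cube

/-! ### Indicators of cylinders -/

namespace Omega

theorem cycleMean_add_smul (f g : Omega a ha → ℝ) (r : ℝ) (c : ℕ × Omega a ha) :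
    cycleMean (fun x => f x + r * g x) c = cycleMean f c + r * cycleMean g c := by
  simp only [cycleMean, birkhoffSum, Finset.sum_add_distrib, ← Finset.mul_sum]
  ring

/-- The indicator function of a cylinder. -/
def wordFun {n : ℕ} (w : Fin (n + 1) → Fin 2) (x : Omega a ha) : ℝ :=
  if ∀ m : Fin (n + 1), x.toSeq m = w m then 1 else 0

theorem wordFun_mem {n : ℕ} (w : Fin (n + 1) → Fin 2) (x : Omega a ha) :
    0 ≤ wordFun w x ∧ wordFun w x ≤ 1 := by
  rw [wordFun]
  split_ifs <;> norm_num

theorem isBlock_wordFun {n : ℕ} (w : Fin (n + 1) → Fin 2) :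
    IsBlock n (wordFun w : Omega a ha → ℝ) := by
  intro x y h
  have : (∀ m : Fin (n + 1), x.toSeq m = w m) ↔ ∀ m : Fin (n + 1), y.toSeq m = w m :=
    forall_congr' fun m => by rw [h m (by omega)]
  exact if_congr this rfl rfl

/-- The indicator can change only between points at distance at least `a n`. -/
theorem lipschitzWith_wordFun {n : ℕ} (w : Fin (n + 1) → Fin 2) :
    LipschitzWith (Real.toNNReal (a n)⁻¹) (wordFun w : Omega a ha → ℝ) := by
  refine LipschitzWith.of_dist_le_mul fun x y => ?_
  rw [Real.coe_toNNReal _ (inv_nonneg.mpr (ha.pos n).le)]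
  by_cases h : ∀ i ≤ n, x.toSeq i = y.toSeq i
  · rw [isBlock_wordFun w x y h, dist_self]
    exact mul_nonneg (inv_nonneg.mpr (ha.pos n).le) dist_nonneg
  · rw [← dist_lt_iff, not_lt] at h
    have h1 : 1 ≤ (a n)⁻¹ * dist x y := by
      rw [inv_mul_eq_div, one_le_div (ha.pos n)]
      exact h
    refine le_trans ?_ h1
    rw [Real.dist_eq, abs_sub_le_iff]
    have hx := wordFun_mem w x
    have hy := wordFun_mem w y
    constructor <;> linarith

/-- The indicator function of a cylinder, as a Lipschitz function. -/
def wordLip {n : ℕ} (w : Fin (n + 1) → Fin 2) : CLip (Omega a ha) :=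
  (⟨⟨wordFun w, (isBlock_wordFun w).continuous⟩, _, lipschitzWith_wordFun w⟩ :
    lipSubmodule (Omega a ha))

theorem toCont_wordLip {n : ℕ} (w : Fin (n + 1) → Fin 2) (x : Omega a ha) :
    (wordLip w).toCont x = wordFun w x := rfl

theorem norm_wordLip_le {n : ℕ} (w : Fin (n + 1) → Fin 2) :
    ‖(wordLip w : CLip (Omega a ha))‖ ≤ 1 + (a n)⁻¹ := by
  rw [CLip.norm_eq]
  refine add_le_add ((ContinuousMap.norm_le _ zero_le_one).mpr fun x => ?_) ?_
  · rw [toCont_wordLip, Real.norm_of_nonneg (wordFun_mem w x).1]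
    exact (wordFun_mem w x).2
  · have h := NNReal.coe_le_coe.mpr
      (CLip.lip_le (f := (wordLip w : CLip (Omega a ha))) (lipschitzWith_wordFun w))
    rwa [Real.coe_toNNReal _ (inv_nonneg.mpr (ha.pos n).le)] at h

theorem cycleMean_wordFun_of_visits {n : ℕ} {w : Fin (n + 1) → Fin 2} {c : ℕ × Omega a ha}
    (hc : c ∈ cycles a ha n) (hv : Visits w c) : ((2 : ℝ) ^ n)⁻¹ ≤ cycleMean (wordFun w) c := by
  obtain ⟨k, hk, hkw⟩ := hv
  have h1 : 1 ≤ birkhoffSum (shift a ha) (wordFun w) c.1 c.2 := by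
    have h2 : wordFun w ((shift a ha)^[k] c.2) = 1 :=
      if_pos fun m => by rw [shift_iterate_toSeq, hkw]
    rw [← h2]
    exact Finset.single_le_sum (f := fun k => wordFun w ((shift a ha)^[k] c.2))
      (fun i _ => (wordFun_mem w _).1) (Finset.mem_range.mpr hk)
  have h2 : (c.1 : ℝ) ≤ 2 ^ n := by exact_mod_cast hc.2.1
  have h3 : (0 : ℝ) < c.1 := by exact_mod_cast hc.1
  rw [cycleMean, inv_eq_one_div]
  exact div_le_div₀ (by linarith) h1 h3 h2

theorem cycleMean_wordFun_of_not_visits {n : ℕ} {w : Fin (n + 1) → Fin 2} {c : ℕ × Omega a ha}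
    (hv : ¬ Visits w c) : cycleMean (wordFun w) c = 0 := by
  rw [cycleMean, birkhoffSum, Finset.sum_eq_zero, zero_div]
  intro k hk
  refine if_neg fun h => hv ⟨k, Finset.mem_range.mp hk, fun m => ?_⟩
  rw [← shift_iterate_toSeq, h]

/-- The set of `r` for which `f + r * 1_[w]` has no gap at `w` has diameter at most
`2 * δ * 2 ^ n`. -/
theorem le_of_not_gapAt {n : ℕ} {δ r : ℝ} {f g : Omega a ha → ℝ} {w : Fin (n + 1) → Fin 2}
    (hr : 0 ≤ r) (hg : ∀ x, g x = f x + r * wordFun w x) (hf : ¬ GapAt δ f w)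
    (hg' : ¬ GapAt δ g w) : r ≤ 2 * δ * 2 ^ n := by
  have hgm : ∀ c, cycleMean g c = cycleMean f c + r * cycleMean (wordFun w) c := fun c => by
    rw [← cycleMean_add_smul]
    exact congrArg (cycleMean · c) (funext hg)
  -- A fixed point whose symbol differs from the first letter of `w` avoids `w`, so the maximum over
  -- the avoiding cycles exists.
  have hne : ¬ Visits w (constCycle (w 0 + 1) : ℕ × Omega a ha) := by
    rintro ⟨k, -, hk⟩
    have h0 : w 0 + 1 = w 0 := hk 0
    generalize w 0 = s at h0
    revert s
    decide
  obtain ⟨c₀, ⟨hc₀, hv₀⟩, hmax⟩ := Set.exists_max_image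
    {c | c ∈ cycles a ha n ∧ ¬ Visits w c} (cycleMean f)
    ((finite_cycles n).subset fun c hc => hc.1) ⟨_, constCycle_mem n _, hne⟩
  rw [GapAt, not_or] at hf hg'
  have h1 := hf.2
  have h2 := hg'.1
  -- Without a gap for `f`, some `c₁` through `w` comes within `δ` of the best avoiding cycle `c₀`.
  -- Without a gap for `g`, some avoiding `c₂` comes within `δ` of `c₁`, although `c₁` has gained at
  -- least `r / 2 ^ n`. As `c₂` is no better than `c₀`, this gain is at most `2 * δ`.
  push Not at h1 h2
  obtain ⟨c₁, hc₁, hv₁, h1⟩ := h1 c₀ hc₀ hv₀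
  obtain ⟨c₂, hc₂, hv₂, h2⟩ := h2 c₁ hc₁ hv₁
  have h3 := hmax c₂ ⟨hc₂, hv₂⟩
  rw [hgm, hgm, cycleMean_wordFun_of_not_visits hv₂] at h2
  have h4 := mul_le_mul_of_nonneg_left (cycleMean_wordFun_of_visits hc₁ hv₁) hr
  have h5 : r * ((2 : ℝ) ^ n)⁻¹ ≤ 2 * δ := by linarith
  rwa [← div_eq_mul_inv, div_le_iff₀ (by positivity)] at h5

/-! ### The locking property from gaps -/

theorem isOpen_lockedSet : IsOpen (lockedSet a ha) := by
  refine Metric.isOpen_iff.mpr fun f hf => ?_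
  obtain ⟨μ, hper, hf, ε, hε, h⟩ := hf
  refine ⟨ε / 2, by positivity, fun g hg => ?_⟩
  rw [Metric.mem_ball, dist_eq_norm] at hg
  refine ⟨μ, hper, h g (by linarith), ε / 2, by positivity, fun k hk => h k ?_⟩
  have := norm_add_le (k - g) (g - f)
  rw [sub_add_sub_cancel] at this
  linarith

theorem hasLocking_of_gapAt {n : ℕ} (hn : ∀ j ≥ n + 1, a (j + 1) ≤ a j / 2)
    {f : CLip (Omega a ha)} {D : ℝ} (hD : ‖f‖ ≤ D)
    (hgap : ∀ w : Fin (n + 1) → Fin 2, GapAt (8 * (D + 1) * a (n + 1)) f.toCont w) :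
    f ∈ lockedSet a ha := by
  have hD0 : 0 ≤ D := (norm_nonneg f).trans hD
  have han := ha.pos (n + 1)
  -- The block approximation samples `f` at the point with zeros after index `n`; the error is at
  -- most `D * a (n + 1)`.
  let F : Omega a ha → ℝ := fun x => f.toCont (ofSeq fun k => if k ≤ n then x.toSeq k else 0)
  have hF : IsBlock n F := by
    intro x y h
    have : (fun k => if k ≤ n then x.toSeq k else 0) = fun k => if k ≤ n then y.toSeq k else 0 := by
      funext k
      split_ifs with hk
      · exact h k hk
      · rfl
    simp only [F, this]
  have hlip : ∀ (g : CLip (Omega a ha)) (x y), |g.toCont x - g.toCont y| ≤ ‖g‖ * dist x y :=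
    fun g x y => (g.lipschitzWith_lip.dist_le_mul x y).trans
      (mul_le_mul_of_nonneg_right (CLip.lip_le_norm g) dist_nonneg)
  have hfF : ∀ x, |f.toCont x - F x| ≤ D * a (n + 1) := fun x =>
    (hlip f _ _).trans (mul_le_mul hD (dist_le_of_agree fun i hi => by
      rw [toSeq_ofSeq, if_pos (by omega)]) dist_nonneg hD0)
  obtain ⟨c, hc, hs, hmax⟩ := hF.exists_isSimple
  have key : ∀ g : CLip (Omega a ha), ‖g - f‖ < min (a (n + 1)) 1 →
      IsUniqueMaximizing (shift a ha) g.toCont (orbitMeasure c) := by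
    intro g hg
    obtain ⟨h1, h2⟩ := lt_min_iff.mp hg
    set ε := ‖g - f‖ with hε
    have hε0 : 0 ≤ ε := norm_nonneg _
    have hgf : ‖g‖ ≤ D + ε := by
      have := norm_add_le f (g - f)
      rw [add_sub_cancel] at this
      linarith
    -- Passing from `f` to `F` costs `2 * D * a (n + 1)` of the gap. The terms in `η` and `L` need
    -- less than `4 * (D + 1) * a (n + 1)`, since `ε` is below both `a (n + 1)` and `1`; the factor
    -- `8` covers both.
    refine isUniqueMaximizing_of_gapAt (η := ε + D * a (n + 1)) (L := D + ε) hn hF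
      (fun w => (hgap w).of_abs_sub_le hfF) hc hs hmax (by linarith)
      (fun x y => (hlip g x y).trans (mul_le_mul_of_nonneg_right hgf dist_nonneg))
      (fun x => ?_) ?_
    · have h3 : |g.toCont x - f.toCont x| ≤ ε :=
        ((g - f).toCont.norm_coe_le_norm x).trans (CLip.norm_toCont_le _)
      exact (abs_sub_le _ (f.toCont x) _).trans (add_le_add h3 (hfF x))
    · have h4 : ε * a (n + 1) ≤ 1 * a (n + 1) := mul_le_mul_of_nonneg_right h2.le han.le
      have h5 := mul_nonneg hD0 han.le
      nlinarith
  have hmin : 0 < min (a (n + 1)) 1 := lt_min han one_pos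
  exact ⟨orbitMeasure c, isPeriodicMeasure_orbitMeasure hc.1 hc.2.2,
    key f (by rwa [sub_self, norm_zero]), _, hmin, key⟩

end Omega

/-! ### The random Lipschitz function -/

namespace Omega

/-- The words of positive length. -/
abbrev Word : Type := Σ n : ℕ, (Fin (n + 1) → Fin 2)

variable (a) in
/-- The amplitude of the random coefficient of the indicator of the cylinder of a word. -/
def amplitude (i : Word) : ℝ := a i.1 / 4 ^ (i.1 + 1)

/-- The factor `a n` of the amplitude cancels the Lipschitz constant `1 / a n` of the indicator, and
`4 ^ (n + 1)` outweighs the `2 ^ (n + 1)` words of length `n + 1`. -/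
theorem norm_smul_wordLip_le (i : Word) (s : unitInterval) :
    ‖((s : ℝ) * amplitude a i) • (wordLip i.2 : CLip (Omega a ha))‖ ≤
      (a 0 + 1) / 4 ^ (i.1 + 1) := by
  have ha0 := ha.pos i.1
  have hb : 0 < amplitude a i := div_pos ha0 (by positivity)
  rw [norm_smul, Real.norm_of_nonneg (mul_nonneg s.2.1 hb.le)]
  calc (s : ℝ) * amplitude a i * ‖(wordLip i.2 : CLip (Omega a ha))‖
      ≤ 1 * amplitude a i * (1 + (a i.1)⁻¹) :=
        mul_le_mul (mul_le_mul_of_nonneg_right s.2.2 hb.le) (norm_wordLip_le i.2)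
          (norm_nonneg _) (by linarith)
    _ = (a i.1 + 1) / 4 ^ (i.1 + 1) := by
        rw [amplitude]
        field_simp
    _ ≤ _ := by
        have := ha.strictAnti.antitone (Nat.zero_le i.1)
        gcongr

theorem summable_word (K : ℝ) (hK : 0 ≤ K) : Summable fun i : Word => K / 4 ^ (i.1 + 1) := by
  rw [summable_sigma_of_nonneg fun i => by positivity]
  refine ⟨fun n => (hasSum_fintype _).summable, ?_⟩
  have h : ∀ n : ℕ, ∑' _ : Fin (n + 1) → Fin 2, K / (4 : ℝ) ^ (n + 1) = K / 2 * (1 / 2) ^ n := by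
    intro n
    have h4 : (4 : ℝ) ^ (n + 1) = 2 ^ (n + 1) * 2 ^ (n + 1) := by rw [← mul_pow]; norm_num
    rw [tsum_fintype, Finset.sum_const, Finset.card_univ, Fintype.card_fun, Fintype.card_fin,
      Fintype.card_fin, nsmul_eq_mul, h4, one_div, inv_pow, pow_succ]
    push_cast
    field_simp
    ring
  simp only [h]
  exact (summable_geometric_of_lt_one (by norm_num) (by norm_num)).mul_left _

variable (a ha) in
/-- The Lipschitz function with given normalized coefficients on the indicators of cylinders. -/
def randomLip (t : Word → unitInterval) : CLip (Omega a ha) :=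
  ∑' i, ((t i : ℝ) * amplitude a i) • wordLip i.2

theorem summable_bound (ha : DecreasesToZero a) :
    Summable fun i : Word => (a 0 + 1) / 4 ^ (i.1 + 1) :=
  summable_word _ (by linarith [ha.pos 0])

theorem hasSum_randomLip (t : Word → unitInterval) :
    HasSum (fun i => ((t i : ℝ) * amplitude a i) • (wordLip i.2 : CLip (Omega a ha)))
      (randomLip a ha t) :=
  (Summable.of_norm_bounded (summable_bound ha) fun i =>
    norm_smul_wordLip_le i (t i)).hasSum

/-- Uniform convergence on the compact cube; the law of the random function is therefore compactly
supported. -/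
theorem continuous_randomLip : Continuous (randomLip a ha) :=
  have hcoord : ∀ i : Word, Continuous fun t : Word → unitInterval => (t i : ℝ) := fun i =>
    continuous_subtype_val.comp (continuous_apply i)
  continuous_tsum (fun i => ((hcoord i).mul continuous_const).smul continuous_const)
    (summable_bound ha) fun i t => norm_smul_wordLip_le i (t i)

theorem norm_randomLip_le (t : Word → unitInterval) :
    ‖randomLip a ha t‖ ≤ ∑' i : Word, (a 0 + 1) / 4 ^ (i.1 + 1) :=
  tsum_of_norm_bounded (summable_bound ha).hasSum fun i => norm_smul_wordLip_le i (t i)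

theorem randomLip_update (t : Word → unitInterval) (e : Word) (s s' : unitInterval) :
    randomLip a ha (Function.update t e s') = randomLip a ha (Function.update t e s) +
      (((s' : ℝ) - s) * amplitude a e) • wordLip e.2 := by
  have h := (hasSum_randomLip (ha := ha) (Function.update t e s)).add
    (hasSum_ite_eq e ((((s' : ℝ) - s) * amplitude a e) • (wordLip e.2 : CLip (Omega a ha))))
  refine HasSum.unique ?_ h
  convert hasSum_randomLip (ha := ha) (Function.update t e s') using 2 with i
  by_cases hi : i = e
  · subst hi
    rw [if_pos rfl, Function.update_self, Function.update_self, ← add_smul]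
    congr 1
    ring
  · rw [if_neg hi, add_zero, Function.update_of_ne hi, Function.update_of_ne hi]

/-! ### Gap conditions on the random function -/

theorem continuous_cycleMean {n : ℕ} {c : ℕ × Omega a ha} (hc : c ∈ cycles a ha n) :
    Continuous fun f : CLip (Omega a ha) => cycleMean f.toCont c := by
  have h : ∀ f g : CLip (Omega a ha),
      cycleMean f.toCont c ≤ cycleMean g.toCont c + 1 * dist f g := by
    intro f g
    refine cycleMean_le_add (fun x => ?_) hc.1
    have h1 := (le_abs_self _).trans
      (((f - g).toCont.norm_coe_le_norm x).trans (CLip.norm_toCont_le _))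
    rw [one_mul, dist_eq_norm]
    have h2 : (f - g).toCont x = f.toCont x - g.toCont x := rfl
    linarith
  exact (LipschitzWith.of_le_add_mul 1 h).continuous

theorem isClosed_gapAt {n : ℕ} (δ : ℝ) (w : Fin (n + 1) → Fin 2) :
    IsClosed {f : CLip (Omega a ha) | GapAt δ f.toCont w} := by
  have hfin := finite_cycles (ha := ha) n
  have key : ∀ p q : ℕ × Omega a ha → Prop, IsClosed {f : CLip (Omega a ha) |
      ∃ c ∈ cycles a ha n, p c ∧ ∀ c' ∈ cycles a ha n, q c' →
        cycleMean f.toCont c' + δ ≤ cycleMean f.toCont c} := by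
    intro p q
    have : {f : CLip (Omega a ha) | ∃ c ∈ cycles a ha n, p c ∧ ∀ c' ∈ cycles a ha n, q c' →
        cycleMean f.toCont c' + δ ≤ cycleMean f.toCont c} =
        ⋃ c ∈ {c | c ∈ cycles a ha n ∧ p c}, ⋂ c' ∈ {c' | c' ∈ cycles a ha n ∧ q c'},
          {f : CLip (Omega a ha) | cycleMean f.toCont c' + δ ≤ cycleMean f.toCont c} := by
      ext f
      simp [and_assoc]
    rw [this]
    refine (hfin.subset fun c hc => hc.1).isClosed_biUnion fun c hc => ?_
    exact isClosed_biInter fun c' hc' =>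
      isClosed_le ((continuous_cycleMean hc'.1).add continuous_const) (continuous_cycleMean hc.1)
  exact (key _ _).union (key _ _)

/-- The law of the normalized coefficients. -/
def cubeMeasure : Measure (Word → unitInterval) := Measure.infinitePi fun _ => volume

instance : IsProbabilityMeasure cubeMeasure := by
  rw [cubeMeasure]
  infer_instance

/-- Only the coefficient of `w` itself is varied, so the bound is uniform in the other coefficients
and in the translation `v`. -/
theorem cubeMeasure_not_gapAt_le {n : ℕ} {δ : ℝ} (hδ : 0 ≤ δ) (w : Fin (n + 1) → Fin 2)
    (v : CLip (Omega a ha)) :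
    cubeMeasure {t | ¬ GapAt δ (randomLip a ha t + v).toCont w} ≤
      ENNReal.ofReal (2 * δ * 2 ^ n * 4 ^ (n + 1) / a n) := by
  have hadd : Continuous fun t => randomLip a ha t + v :=
    continuous_randomLip.add continuous_const
  have hcl := (isClosed_gapAt (ha := ha) δ w).preimage hadd
  refine infinitePi_unitInterval_le (ι := Word) hcl.measurableSet.compl ⟨n, w⟩
    fun t s s' hs hs' => ?_
  have han := ha.pos n
  have hb : 0 < amplitude a ⟨n, w⟩ := div_pos han (by positivity)
  rcases le_or_gt (s' : ℝ) s with hss | hss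
  · have : 0 ≤ 2 * δ * 2 ^ n * 4 ^ (n + 1) / a n := by positivity
    linarith
  · have h := le_of_not_gapAt (r := ((s' : ℝ) - s) * amplitude a ⟨n, w⟩)
      (mul_nonneg (by linarith) hb.le) (fun x => ?_) hs hs'
    · rw [amplitude, ← mul_div_assoc, div_le_iff₀ (by positivity)] at h
      rw [le_div_iff₀ han]
      exact h
    · beta_reduce
      rw [randomLip_update t ⟨n, w⟩ s s']
      simp only [CLip.toCont_add, CLip.toCont_smul, ContinuousMap.add_apply,
        ContinuousMap.smul_apply, smul_eq_mul, toCont_wordLip]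
      ring

end Omega

/-! ### Evanescence and the probability of failure -/

theorem Evanescent.tendsto_ratio (ha : Evanescent a) :
    Tendsto (fun n : ℕ => 16 ^ (n + 1) * (a (n + 1) / a n)) atTop (𝓝 0) := by
  obtain ⟨C, hC⟩ := ha.ratio.bound
  have hgeo : Tendsto (fun n : ℕ => C * (1 / 2 : ℝ) ^ (n + 1)) atTop (𝓝 0) := by
    have h := ((tendsto_pow_atTop_nhds_zero_of_lt_one (r := (1 / 2 : ℝ)) (by norm_num)
      (by norm_num)).comp (tendsto_add_atTop_nat 1)).const_mul C
    rwa [mul_zero] at h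
  refine squeeze_zero' (Eventually.of_forall fun n => mul_nonneg (by positivity)
    (div_pos (ha.decreases.pos _) (ha.decreases.pos _)).le) ?_ hgeo
  filter_upwards [hC, eventually_ge_atTop 2] with n hn hn2
  rw [Real.norm_of_nonneg (div_pos (ha.decreases.pos _) (ha.decreases.pos _)).le,
    Real.norm_of_nonneg (by positivity)] at hn
  -- This gives `32 ^ (n + 1) ≤ 2 ^ (2 ^ (n + 2))` for `n ≥ 2`, and `32 = 2 * 16` leaves a geometric
  -- factor `1 / 2`.
  have hexp : ∀ m : ℕ, 5 * (m + 2 + 1) ≤ 2 ^ (m + 2 + 2) := by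
    intro m
    induction m with
    | zero => norm_num
    | succ m ih =>
      have : 2 ^ (m + 1 + 2 + 2) = 2 * 2 ^ (m + 2 + 2) := by ring
      omega
  obtain ⟨m, rfl⟩ := Nat.exists_eq_add_of_le' hn2
  have hpow : (32 : ℝ) ^ (m + 2 + 1) ≤ 2 ^ (2 ^ (m + 2 + 2)) := by
    rw [show (32 : ℝ) = 2 ^ 5 by norm_num, ← pow_mul]
    exact pow_le_pow_right₀ (by norm_num) (hexp m)
  have hC0 : 0 ≤ C := by
    have h1 := (div_pos (ha.decreases.pos (m + 2 + 1)) (ha.decreases.pos (m + 2))).le.trans hn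
    exact nonneg_of_mul_nonneg_left h1 (by positivity)
  calc 16 ^ (m + 2 + 1) * (a (m + 2 + 1) / a (m + 2))
      ≤ 16 ^ (m + 2 + 1) * (C * ((32 : ℝ) ^ (m + 2 + 1))⁻¹) := by
        refine mul_le_mul_of_nonneg_left (hn.trans (mul_le_mul_of_nonneg_left ?_ hC0))
          (by positivity)
        exact inv_anti₀ (by positivity) hpow
    _ = C * (1 / 2 : ℝ) ^ (m + 2 + 1) := by
        rw [show (1 / 2 : ℝ) = 16 / 32 by norm_num, div_pow]
        ring

open Omega in
theorem cubeMeasure_not_locked (ha : Evanescent a) (v : CLip (Omega a ha.decreases)) :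
    cubeMeasure {t | randomLip a ha.decreases t + v ∉ lockedSet a ha.decreases} = 0 := by
  set D : ℝ := (∑' i : Word, (a 0 + 1) / 4 ^ (i.1 + 1)) + ‖v‖ with hD
  have hD0 : 0 ≤ D :=
    add_nonneg (tsum_nonneg fun i => div_nonneg (by linarith [ha.decreases.pos 0])
      (by positivity)) (norm_nonneg v)
  have hratio := ha.tendsto_ratio
  have hpos := ha.decreases.pos
  have hlim : Tendsto (fun n : ℕ => ENNReal.ofReal
      (16 * (D + 1) * (16 ^ (n + 1) * (a (n + 1) / a n)))) atTop (𝓝 0) := by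
    have h := ENNReal.tendsto_ofReal (hratio.const_mul (16 * (D + 1)))
    rwa [mul_zero, ENNReal.ofReal_zero] at h
  -- The set does not depend on `n`, so a bound that holds for all large `n` and tends to zero makes
  -- it null; no independence between levels is needed.
  refine le_antisymm (ge_of_tendsto hlim ?_) bot_le
  have hhalf : ∀ᶠ n in atTop, ∀ j ≥ n, a (j + 1) ≤ a j / 2 := by
    refine eventually_forall_ge_atTop.mpr ?_
    filter_upwards [hratio.eventually_le_const one_pos] with n hn
    rw [← mul_div_assoc, div_le_one (hpos n)] at hn
    have h1 : (2 : ℝ) ≤ 16 ^ (n + 1) := by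
      calc (2 : ℝ) ≤ 16 := by norm_num
        _ ≤ 16 ^ (n + 1) := le_self_pow₀ (by norm_num) (by omega)
    have := mul_le_mul_of_nonneg_right h1 (hpos (n + 1)).le
    linarith
  filter_upwards [hhalf] with n hn
  have hsub : {t | randomLip a ha.decreases t + v ∉ lockedSet a ha.decreases} ⊆
      ⋃ w : Fin (n + 1) → Fin 2, {t | ¬ GapAt (8 * (D + 1) * a (n + 1))
        (randomLip a ha.decreases t + v).toCont w} := by
    intro t ht
    by_contra hnot
    simp only [Set.mem_iUnion, Set.mem_ofPred_eq, not_exists, not_not] at hnot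
    exact ht (hasLocking_of_gapAt (fun j hj => hn j (by omega))
      ((norm_add_le _ _).trans (add_le_add_left (norm_randomLip_le t) _)) hnot)
  have hcard : Fintype.card (Fin (n + 1) → Fin 2) = 2 ^ (n + 1) := by simp
  have han := hpos n
  calc cubeMeasure {t | randomLip a ha.decreases t + v ∉ lockedSet a ha.decreases}
      ≤ ∑ w : Fin (n + 1) → Fin 2, cubeMeasure {t | ¬ GapAt (8 * (D + 1) * a (n + 1))
          (randomLip a ha.decreases t + v).toCont w} :=
        (measure_mono hsub).trans (measure_iUnion_fintype_le _ _)
    _ ≤ ∑ _ : Fin (n + 1) → Fin 2,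
          ENNReal.ofReal (2 * (8 * (D + 1) * a (n + 1)) * 2 ^ n * 4 ^ (n + 1) / a n) :=
        Finset.sum_le_sum fun w _ => cubeMeasure_not_gapAt_le (mul_nonneg (by linarith) (hpos _).le) w v
    _ = ENNReal.ofReal (2 ^ (n + 1) *
          (2 * (8 * (D + 1) * a (n + 1)) * 2 ^ n * 4 ^ (n + 1) / a n)) := by
        rw [Finset.sum_const, Finset.card_univ, hcard, nsmul_eq_mul,
          ENNReal.ofReal_mul (by positivity), ENNReal.ofReal_pow (by norm_num)]
        simp
    _ ≤ _ := by
        refine ENNReal.ofReal_le_ofReal ?_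
        have h16 : (16 : ℝ) ^ (n + 1) = 2 ^ (n + 1) * (2 ^ n * 2) * 4 ^ (n + 1) := by
          rw [← pow_succ, ← mul_pow, ← mul_pow]
          norm_num
        have hX : 0 ≤ (D + 1) * (2 ^ (n + 1) * 2 ^ n * 4 ^ (n + 1)) * (a (n + 1) / a n) := by
          have := hpos (n + 1)
          positivity
        rw [h16]
        calc _ = 16 * ((D + 1) * (2 ^ (n + 1) * 2 ^ n * 4 ^ (n + 1)) * (a (n + 1) / a n)) := by
              ring
          _ ≤ 32 * ((D + 1) * (2 ^ (n + 1) * 2 ^ n * 4 ^ (n + 1)) * (a (n + 1) / a n)) := by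
              linarith
          _ = _ := by ring

end

theorem theorem1p1 (a : ℕ → ℝ) (ha : Evanescent a) :
    IsPrevalent (lockedSet a ha.decreases) := by
  have hcont := Omega.continuous_randomLip (ha := ha.decreases)
  have hS : IsClosed (lockedSet a ha.decreases)ᶜ := Omega.isOpen_lockedSet.isClosed_compl
  refine ⟨(lockedSet a ha.decreases)ᶜ, ⟨hS.measurableSet,
    Omega.cubeMeasure.map (Omega.randomLip a ha.decreases),
    Measure.isProbabilityMeasure_map hcont.measurable.aemeasurable,
    ⟨Set.range (Omega.randomLip a ha.decreases), isCompact_range hcont, ?_⟩, fun v => ?_⟩,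
    subset_rfl⟩
  · rw [Measure.map_apply hcont.measurable (isCompact_range hcont).isClosed.measurableSet.compl]
    simp
  · have hadd : Continuous fun f : CLip (Omega a ha.decreases) => f + -v :=
      continuous_id.add continuous_const
    -- Membership of `f` in the translate by `v` means that `f - v` is not locked, so the estimate
    -- is applied to `-v`.
    rw [Set.image_add_right, Measure.map_apply hcont.measurable (hS.preimage hadd).measurableSet]
    exact cubeMeasure_not_locked ha (-v)
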